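/- For a finite probability vector $p$ and $\alpha\in[0,\infty]$ let $H_\alpha(p)=\frac1{1-\alpha}\log\sum_{x:\,p(x)>0}p(x)^\alpha$ denote the Rényi entropy, with $H_1(p)=-\sum_x p(x)\log p(x)$ and $H_\infty(p)=-\log\max_x p(x)$. For a joint probability distribution $P=P_{XY}$ on a finite set $\mathcal X\times\mathcal Y$ (viewed as a matrix), $t\in\mathbb R\setminus\{0\}$ and a Borel probability measure $\tau$ on $[0,\infty]$, put $$H_{t,\tau}(X|Y)_P=\frac1t\log\sum_{y}P_Y(y)\exp\Big(t\int_{[0,\infty]}H_\alpha(P_{X|Y=y})\,d\tau(\alpha)\Big),\qquad H_{-\infty,\tau}(X|Y)_P=\min_{y:\,P_Y(y)>0}\int_{[0,\infty]}H_\alpha(P_{X|Y=y})\,d\tau(\alpha).$$ (Here $\log$ and $\exp$ are natural; any common base gives the same parameter sets.) A conditionally mixing channel is a map $P_{XY}\mapsto Q_{XY'}=\sum_{i=1}^k S^{(i)}P_{XY}D^{(i)}$ with doubly stochastic $S^{(i)}$ and row sub-stochastic $D^{(i)}$ (nonnegative entries) whose sum $\sum_i D^{(i)}$ is row-stochastic.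 Let $\mathcal D_{\rm bulk}$ be the set of pairs $(t,\tau)$, $t\neq0$, such that $H_{t,\tau}(X|Y)_P\le H_{t,\tau}(X|Y')_Q$ whenever $Q$ is obtained from a joint distribution $P$ by a conditionally mixing channel, and let $\mathcal D_{-\infty}$ be the set of $\tau$ for which $H_{-\infty,\tau}$ has the same property. Write $I(\tau)=\int_{[0,\infty]}\frac{\alpha}{1-\alpha}\,d\tau(\alpha)\in[-\infty,+\infty]$, where the integrand is $-1$ at $\alpha=\infty$ and $I(\tau)=+\infty$ by convention if $\tau(\{1\})>0$. Let $\widetilde{\mathcal D}_{\rm bulk}$ be the set of pairs $(t,\tau)$ such that one of the following holds: 1. $t>0$, $\operatorname{supp}\tau\subseteq[0,1]$ and $I(\tau)\le 1/t$; 2. (a) $t<0$ and $\operatorname{supp}\tau\subseteq[0,1]$; 2. (b) $t<0$, $\operatorname{supp}\tau\subseteq[0,1]\cup\{\alpha_*\}$ for some $\alpha_*\in(1,\infty]$, and $I(\tau)\le1/t$. Let $\widetilde{\mathcal D}_{-\infty}$ be the set of $\tau$ such that either $\operatorname{supp}\tau\subseteq[0,1]$, or $\operatorname{supp}\tau\subseteq[0,1]\cup\{\alpha_*\}$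 for some $\alpha_*\in(1,\infty]$ and $I(\tau)\le0$. Then $\widetilde{\mathcal D}_{\rm bulk}\subseteq\mathcal D_{\rm bulk}$ and $\widetilde{\mathcal D}_{-\infty}\subseteq\mathcal D_{-\infty}$. Moreover, if $\tau$ satisfies $$\Big|\int_{[0,1)}\frac{\alpha}{1-\alpha}\,d\tau(\alpha)\Big|<\infty\quad\text{and}\quad\Big|\int_{(1,\infty]}\frac{\alpha}{1-\alpha}\,d\tau(\alpha)\Big|<\infty,$$ then $(t,\tau)\in\mathcal D_{\rm bulk}$ implies $(t,\tau)\in\widetilde{\mathcal D}_{\rm bulk}$, so that for such $\tau$ one has $(t,\tau)\in\mathcal D_{\rm bulk}$ if and only if $(t,\tau)\in\widetilde{\mathcal D}_{\rm bulk}$. Every $\tau$ with finite support satisfies these two finiteness conditions. -/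

import Mathlib

open MeasureTheory Set
open scoped ENNReal Matrix

namespace CondEntropy

/-- The Rényi entropy `H_α(p)` of a finite probability vector `p`, for `α ∈ [0,∞]`, with the Shannon
entropy at `α = 1` and the min-entropy at `α = ∞`. For `α = 0` it is `log |{x | p x ≠ 0}|`. -/
noncomputable def renyi {X : Type*} [Fintype X] (α : ℝ≥0∞) (p : X → ℝ) : ℝ :=
  open Classical in
  if α = ⊤ then -Real.log (⨆ x, p x)
  else if α = 1 then ∑ x, Real.negMulLog (p x)
  else (1 / (1 - α.toReal)) * Real.log (∑ x with p x ≠ 0, p x ^ α.toReal)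

/-- `P` is a joint probability mass function on `X × Y`. -/
def IsProb {X Y : Type*} [Fintype X] [Fintype Y] (P : Matrix X Y ℝ) : Prop :=
  (∀ x y, 0 ≤ P x y) ∧ ∑ x, ∑ y, P x y = 1

/-- The marginal `P_Y`. -/
def marginal {X Y : Type*} [Fintype X] (P : Matrix X Y ℝ) (y : Y) : ℝ := ∑ x, P x y

/-- The conditional distribution `P_{X|Y=y}` (used only where `P_Y(y) > 0`, or with weight `0`). -/
noncomputable def conditional {X Y : Type*} [Fintype X] (P : Matrix X Y ℝ) (y : Y) : X → ℝ :=
  fun x => P x y / marginal P y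

/-- The averaged entropy `∫_{[0,∞]} H_α(p) dτ(α)`; on probability vectors the integrand is bounded
and measurable. -/
noncomputable def avgRenyi {X : Type*} [Fintype X] (τ : ProbabilityMeasure ℝ≥0∞) (p : X → ℝ) : ℝ :=
  ∫ α, renyi α p ∂(τ : Measure ℝ≥0∞)

/-- The conditional entropy `H_{t,τ}(X|Y)_P`. -/
noncomputable def condEntropy {X Y : Type*} [Fintype X] [Fintype Y] (t : ℝ)
    (τ : ProbabilityMeasure ℝ≥0∞) (P : Matrix X Y ℝ) : ℝ :=
  (1 / t) * Real.log (∑ y, marginal P y * Real.exp (t * avgRenyi τ (conditional P y)))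

/-- The conditional entropy `H_{-∞,τ}(X|Y)_P`: the minimum over the finitely many `y` with
`P_Y(y) > 0`. -/
noncomputable def condEntropyNegInfty {X Y : Type*} [Fintype X] [Fintype Y]
    (τ : ProbabilityMeasure ℝ≥0∞) (P : Matrix X Y ℝ) : ℝ :=
  ⨅ y : {y : Y // 0 < marginal P y}, avgRenyi τ (conditional P y)

/-- Nonnegative entries, rows summing to at most one. -/
def IsSubStochastic {Y Y' : Type*} [Fintype Y'] (D : Matrix Y Y' ℝ) : Prop :=
  (∀ y y', 0 ≤ D y y') ∧ ∀ y, ∑ y', D y y' ≤ 1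

/-- Nonnegative entries, rows summing to one. -/
def IsRowStochastic {Y Y' : Type*} [Fintype Y'] (D : Matrix Y Y' ℝ) : Prop :=
  (∀ y y', 0 ≤ D y y') ∧ ∀ y, ∑ y', D y y' = 1

/-- `Q` is the image of `P` under some conditionally mixing channel `P ↦ ∑ i, S i * P * D i`. -/
def CondMixes {X Y Y' : Type*} [Fintype X] [DecidableEq X] [Fintype Y] [Fintype Y']
    (P : Matrix X Y ℝ) (Q : Matrix X Y' ℝ) : Prop :=
  ∃ (k : ℕ) (S : Fin k → Matrix X X ℝ) (D : Fin k → Matrix Y Y' ℝ),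
    (∀ i, S i ∈ doublyStochastic ℝ X) ∧ (∀ i, IsSubStochastic (D i)) ∧
    IsRowStochastic (∑ i, D i) ∧ Q = ∑ i, S i * P * D i

/-- `D_bulk`: all `(t, τ)` with `t ≠ 0` such that `H_{t,τ}` is monotone under conditionally mixing
channels. -/
def Dbulk : Set (ℝ × ProbabilityMeasure ℝ≥0∞) :=
  {q | q.1 ≠ 0 ∧
    ∀ (X Y Y' : Type) [Fintype X] [DecidableEq X] [Fintype Y] [Fintype Y']
      (P : Matrix X Y ℝ) (Q : Matrix X Y' ℝ), IsProb P → CondMixes P Q →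
      condEntropy q.1 q.2 P ≤ condEntropy q.1 q.2 Q}

/-- `D_{-∞}`: all `τ` such that `H_{-∞,τ}` is monotone under conditionally mixing channels. -/
def DnegInfty : Set (ProbabilityMeasure ℝ≥0∞) :=
  {τ | ∀ (X Y Y' : Type) [Fintype X] [DecidableEq X] [Fintype Y] [Fintype Y']
      (P : Matrix X Y ℝ) (Q : Matrix X Y' ℝ), IsProb P → CondMixes P Q →
      condEntropyNegInfty τ P ≤ condEntropyNegInfty τ Q}

/-- The function `α ↦ α / (1 - α)` on `[0,∞]`, with its limit `-1` at `∞`. Its value at `α = 1`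
plays no role: the definitions below treat that point separately. -/
noncomputable def ratio (α : ℝ≥0∞) : ℝ :=
  open Classical in
  if α = ⊤ then -1 else α.toReal / (1 - α.toReal)

/-- The extended integral `∫_{[0,∞]} α / (1 - α) dτ(α)` (positive part minus negative part), which is
`+∞` by convention if `τ` charges the point `1`. Under the support conditions below the negative part
is always finite, so that no `∞ - ∞` occurs. -/
noncomputable def ratioIntegral (τ : ProbabilityMeasure ℝ≥0∞) : EReal :=
  open Classical in
  if (τ : Measure ℝ≥0∞) {1} = 0 then
    ((∫⁻ α, ENNReal.ofReal (ratio α) ∂(τ : Measure ℝ≥0∞) : ℝ≥0∞) : EReal)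
      - ((∫⁻ α, ENNReal.ofReal (-ratio α) ∂(τ : Measure ℝ≥0∞) : ℝ≥0∞) : EReal)
  else ⊤

/-- The explicit set `D̃_bulk`. -/
def DbulkTilde : Set (ℝ × ProbabilityMeasure ℝ≥0∞) :=
  {q | (0 < q.1 ∧ (q.2 : Measure ℝ≥0∞).support ⊆ Icc 0 1 ∧
          ratioIntegral q.2 ≤ ((1 / q.1 : ℝ) : EReal)) ∨
       (q.1 < 0 ∧
         ((q.2 : Measure ℝ≥0∞).support ⊆ Icc 0 1 ∨
          ∃ a : ℝ≥0∞, 1 < a ∧ (q.2 : Measure ℝ≥0∞).support ⊆ Icc 0 1 ∪ {a} ∧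
            ratioIntegral q.2 ≤ ((1 / q.1 : ℝ) : EReal)))}

/-- The explicit set `D̃_{-∞}`. -/
def DnegInftyTilde : Set (ProbabilityMeasure ℝ≥0∞) :=
  {τ | (τ : Measure ℝ≥0∞).support ⊆ Icc 0 1 ∨
       ∃ a : ℝ≥0∞, 1 < a ∧ (τ : Measure ℝ≥0∞).support ⊆ Icc 0 1 ∪ {a} ∧ ratioIntegral τ ≤ 0}

/-- The integrals of `α / (1 - α)` over `[0,1)` and over `(1,∞]` are both finite. -/
def FiniteRatioIntegrals (τ : ProbabilityMeasure ℝ≥0∞) : Prop :=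
  IntegrableOn ratio (Ico 0 1) (τ : Measure ℝ≥0∞) ∧
  IntegrableOn ratio (Ioc 1 ⊤) (τ : Measure ℝ≥0∞)

end CondEntropy

/-!
Write `F(p) = ∫ H_α(p) dτ(α)` and `I = ∫ α / (1 - α) dτ(α)`, and let `D(l, m)` be the relative
entropy of Bernoulli distributions with parameters `l` and `m`.

*Sufficiency.* Birkhoff's theorem and Jensen's inequality reduce monotonicity under conditionally
mixing channels to concavity of `exp (t F)` on the simplex for `t > 0`, to its convexity for
`t < 0`, and to quasiconcavity of `F` for `-∞` (`CondMixes.sum_marginal_mul_le`,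
`CondMixes.le_conditional`).
All of these come from one inequality, linear in the entropies and hence stable under integration
over `α`:
`H_α(m p + (1 - m) q) ≥ l H_α(p) + (1 - l) H_α(q) - α / (1 - α) * D(l, m)`.
For `α < 1` it holds for every weight `l` (`renyi_mix_of_lt_one`), for `α = 1` it holds for `l = m`,
and for each `α > 1` it holds for one `l`, which depends on `α`, by Minkowski's inequality
(`exists_renyi_mix_of_one_lt`); this is why only a single order above `1` is allowed. After
integration, the conditions on `I` let the error term `I * D(l, m)` be absorbed by the Gibbs
variational principle `log (m e^x + (1 - m) e^y) = max_l (l x + (1 - l) y - D(l, m))`. If `τ` lives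
on `[0,1]`, then `l = m` is admissible for all orders and the error vanishes: `F` itself is concave,
whatever `I` is.

*Necessity.* Merging a binary side information gives an inequality for `F` at a mixture
(`condEntropy_le_of_mem_Dbulk`). It is tested on block distributions, which have blocks of about
`exp (b_j L)` points with masses of about `exp (-e_j L)`. As `L → ∞`, `H_α / L` converges to a
maximum of `b_j - α / (1 - α) * e_j` for `α < 1` and to a minimum of the same terms for `α > 1`
(`IsBlockWeight.tendsto_renyi`), and dominated convergence turns monotonicity into piecewise linear
inequalities between integrals over `τ`. Three families of blocks suffice: one for `t > 0`
(`mass_bound_of_pos`), one which bounds `I` for `t < 0` when `τ` charges `(1,∞]`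
(`mass_bound_of_neg`), and one which shows that `τ` charges at most one point of `(1,∞]`
(`exists_ae_eq_const_of_neg`).
-/

namespace CondEntropy

/-! ### Rényi entropies of probability vectors -/

section Basic

variable {X : Type*} [Fintype X]

/-- The power sum `∑ p(x)^a` over the support of `p`. -/
noncomputable def powSum (a : ℝ) (p : X → ℝ) : ℝ :=
  open Classical in ∑ x with p x ≠ 0, p x ^ a

lemma powSum_eq_sum {a : ℝ} (ha : a ≠ 0) (p : X → ℝ) : powSum a p = ∑ x, p x ^ a := by
  classical
  unfold powSum
  rw [Finset.sum_filter]
  refine Finset.sum_congr rfl fun x _ => ?_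
  split_ifs with h
  · rfl
  · rw [not_not.mp h, Real.zero_rpow ha]

lemma renyi_top (p : X → ℝ) : renyi ⊤ p = -Real.log (⨆ x, p x) := by simp [renyi]

lemma renyi_one (p : X → ℝ) : renyi 1 p = ∑ x, Real.negMulLog (p x) := by simp [renyi]

lemma renyi_eq {α : ℝ≥0∞} (h : α ≠ ⊤) (h1 : α ≠ 1) (p : X → ℝ) :
    renyi α p = (1 / (1 - α.toReal)) * Real.log (powSum α.toReal p) := by
  simp [renyi, powSum, h, h1]

lemma ratio_top : ratio ⊤ = -1 := by simp [ratio]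

lemma ratio_eq {α : ℝ≥0∞} (h : α ≠ ⊤) : ratio α = α.toReal / (1 - α.toReal) := by
  simp [ratio, h]

lemma toReal_lt_one {α : ℝ≥0∞} (h : α < 1) : α.toReal < 1 := by
  have := (ENNReal.toReal_lt_toReal h.ne_top ENNReal.one_ne_top).2 h
  simpa using this

lemma one_lt_toReal {α : ℝ≥0∞} (h : 1 < α) (ht : α ≠ ⊤) : 1 < α.toReal := by
  have := (ENNReal.toReal_lt_toReal ENNReal.one_ne_top ht).2 h
  simpa using this

lemma ratio_nonneg {α : ℝ≥0∞} (h : α < 1) : 0 ≤ ratio α := by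
  rw [ratio_eq h.ne_top]
  exact div_nonneg ENNReal.toReal_nonneg (sub_nonneg.2 (toReal_lt_one h).le)

lemma ratio_one : ratio 1 = 0 := by simp [ratio]

lemma ratio_le_neg_one {α : ℝ≥0∞} (h : 1 < α) : ratio α ≤ -1 := by
  by_cases ht : α = ⊤
  · simp [ht, ratio_top]
  · have := one_lt_toReal h ht
    rw [ratio_eq ht, div_le_iff_of_neg (by linarith)]
    linarith

lemma measurable_ratio : Measurable ratio := by
  classical
  unfold ratio
  refine Measurable.ite (measurableSet_singleton _) measurable_const ?_
  exact ENNReal.measurable_toReal.div (measurable_const.sub ENNReal.measurable_toReal)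

lemma measurable_renyi (p : X → ℝ) : Measurable fun α => renyi α p := by
  classical
  unfold renyi
  refine Measurable.ite (measurableSet_singleton _) measurable_const ?_
  refine Measurable.ite (measurableSet_singleton _) measurable_const ?_
  have h1 : Measurable fun α : ℝ≥0∞ => α.toReal := ENNReal.measurable_toReal
  refine (measurable_const.div (measurable_const.sub h1)).mul (Real.measurable_log.comp ?_)
  exact Finset.measurable_sum _ fun x _ => measurable_const.pow h1

variable {p : X → ℝ}

lemma nonempty_of_mem_stdSimplex (hp : p ∈ stdSimplex ℝ X) : Nonempty X := by
  by_contra h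
  rw [not_nonempty_iff] at h
  have := hp.2
  simp at this

lemma powSum_one (hp : p ∈ stdSimplex ℝ X) :
    powSum 1 p = 1 := by
  rw [powSum_eq_sum one_ne_zero]
  simpa using hp.2

lemma powSum_pos (hp : p ∈ stdSimplex ℝ X) (a : ℝ) : 0 < powSum a p := by
  classical
  refine Finset.sum_pos (fun x hx => Real.rpow_pos_of_pos ?_ _) ?_
  · exact lt_of_le_of_ne (hp.1 x) (Ne.symm (Finset.mem_filter.1 hx).2)
  · by_contra h
    rw [Finset.not_nonempty_iff_eq_empty] at h
    have h1 := powSum_one hp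
    simp [powSum, h] at h1

lemma powSum_anti (hp : p ∈ stdSimplex ℝ X) {a b : ℝ} (hab : a ≤ b) :
    powSum b p ≤ powSum a p := by
  classical
  refine Finset.sum_le_sum fun x hx => ?_
  exact Real.rpow_le_rpow_of_exponent_ge
    (lt_of_le_of_ne (hp.1 x) (Ne.symm (Finset.mem_filter.1 hx).2))
    (mem_Icc_of_mem_stdSimplex hp x).2 hab

lemma powSum_le_of_le_one (hp : p ∈ stdSimplex ℝ X) {a : ℝ} (h0 : 0 ≤ a) (h1 : a ≤ 1) :
    powSum a p ≤ (Fintype.card X : ℝ) ^ (1 - a) := by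
  classical
  rcases h0.eq_or_lt with rfl | h0
  · simp only [powSum, Real.rpow_zero, Finset.sum_const, nsmul_eq_mul, mul_one, sub_zero,
      Real.rpow_one]
    exact_mod_cast Finset.card_le_univ _
  · have hge : 1 ≤ 1 / a := by rw [le_div_iff₀ h0]; linarith
    have key := Real.rpow_sum_le_const_mul_sum_rpow Finset.univ (fun x => p x ^ a) hge
    have e1 : ∀ x, |p x ^ a| = p x ^ a := fun x => abs_of_nonneg (Real.rpow_nonneg (hp.1 x) _)
    have e2 : ∀ x, (p x ^ a) ^ (1 / a) = p x := fun x => by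
      rw [← Real.rpow_mul (hp.1 x), mul_one_div_cancel h0.ne', Real.rpow_one]
    simp only [e1, e2, hp.2, mul_one] at key
    rw [powSum_eq_sum h0.ne']
    have hs : 0 ≤ ∑ x, p x ^ a := Finset.sum_nonneg fun x _ => Real.rpow_nonneg (hp.1 x) _
    have := Real.rpow_le_rpow (Real.rpow_nonneg hs _) key h0.le
    rw [← Real.rpow_mul hs, ← Real.rpow_mul (by positivity), one_div_mul_cancel h0.ne',
      Real.rpow_one] at this
    rwa [sub_mul, one_div_mul_cancel h0.ne', one_mul, Finset.card_univ] at this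

lemma le_powSum_of_one_le (hp : p ∈ stdSimplex ℝ X) {a : ℝ} (h1 : 1 ≤ a) :
    (Fintype.card X : ℝ) ^ (1 - a) ≤ powSum a p := by
  have key := Real.rpow_sum_le_const_mul_sum_rpow Finset.univ p h1
  have e1 : ∀ x, |p x| = p x := fun x => abs_of_nonneg (hp.1 x)
  simp only [e1, hp.2, Real.one_rpow] at key
  have := nonempty_of_mem_stdSimplex hp
  have hc : (0 : ℝ) < Fintype.card X := by exact_mod_cast Fintype.card_pos
  rw [show (1 : ℝ) - a = -(a - 1) by ring, Real.rpow_neg hc.le]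
  rw [inv_le_iff_one_le_mul₀ (Real.rpow_pos_of_pos hc _), mul_comm, powSum_eq_sum (by linarith)]
  exact key

lemma one_le_card_mul_iSup (hp : p ∈ stdSimplex ℝ X) :
    1 ≤ (Fintype.card X : ℝ) * ⨆ x, p x := by
  rw [← hp.2, ← nsmul_eq_mul, ← Finset.card_univ]
  exact Finset.sum_le_card_nsmul _ _ _ fun x _ => le_ciSup (Finite.bddAbove_range p) x

lemma iSup_pos_of_mem_stdSimplex (hp : p ∈ stdSimplex ℝ X) : 0 < ⨆ x, p x := by
  by_contra h
  have := one_le_card_mul_iSup hp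
  have : (0 : ℝ) ≤ Fintype.card X := Nat.cast_nonneg _
  nlinarith

lemma renyi_nonneg (hp : p ∈ stdSimplex ℝ X) (α : ℝ≥0∞) : 0 ≤ renyi α p := by
  have := nonempty_of_mem_stdSimplex hp
  by_cases ht : α = ⊤
  · subst ht
    rw [renyi_top]
    have h0 : 0 ≤ ⨆ x, p x := Real.iSup_nonneg hp.1
    have h1 : ⨆ x, p x ≤ 1 := ciSup_le fun x => (mem_Icc_of_mem_stdSimplex hp x).2
    linarith [Real.log_nonpos h0 h1]
  by_cases h1 : α = 1
  · subst h1
    rw [renyi_one]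
    exact Finset.sum_nonneg fun x _ =>
      Real.negMulLog_nonneg (hp.1 x) (mem_Icc_of_mem_stdSimplex hp x).2
  rw [renyi_eq ht h1]
  rcases lt_or_gt_of_ne h1 with h | h
  · have h' := toReal_lt_one h
    refine mul_nonneg (one_div_nonneg.2 (by linarith)) (Real.log_nonneg ?_)
    rw [← powSum_one hp]
    exact powSum_anti hp h'.le
  · have h' := one_lt_toReal h ht
    refine mul_nonneg_of_nonpos_of_nonpos (one_div_nonpos.2 (by linarith))
      (Real.log_nonpos (powSum_pos hp _).le ?_)
    rw [← powSum_one hp]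
    exact powSum_anti hp h'.le

lemma renyi_le_log_card (hp : p ∈ stdSimplex ℝ X) (α : ℝ≥0∞) :
    renyi α p ≤ Real.log (Fintype.card X) := by
  have := nonempty_of_mem_stdSimplex hp
  have hc : (0 : ℝ) < Fintype.card X := by exact_mod_cast Fintype.card_pos
  by_cases ht : α = ⊤
  · subst ht
    rw [renyi_top, ← Real.log_inv]
    have h0 := iSup_pos_of_mem_stdSimplex hp
    refine Real.log_le_log (inv_pos.2 h0) ?_
    rw [inv_le_iff_one_le_mul₀ h0]
    exact one_le_card_mul_iSup hp
  by_cases h1 : α = 1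
  · subst h1
    rw [renyi_one]
    -- Gibbs' inequality against the uniform distribution, from `log x ≤ x - 1`.
    have h : ∀ x, Real.negMulLog (p x) ≤
        p x * Real.log (Fintype.card X) + (1 / (Fintype.card X : ℝ) - p x) := fun x => by
      rcases (hp.1 x).eq_or_lt with h | h
      · simp [← h]
      · have := Real.log_le_sub_one_of_pos (x := 1 / (p x * Fintype.card X)) (by positivity)
        rw [one_div, Real.log_inv, Real.log_mul h.ne' hc.ne'] at this
        have := mul_le_mul_of_nonneg_left this h.le
        have e : p x * ((p x * Fintype.card X)⁻¹ - 1) = 1 / (Fintype.card X : ℝ) - p x := by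
          field_simp
        rw [e] at this
        unfold Real.negMulLog
        linarith
    refine (Finset.sum_le_sum fun x _ => h x).trans ?_
    rw [Finset.sum_add_distrib, ← Finset.sum_mul, Finset.sum_sub_distrib, hp.2]
    simp [hc.ne']
  rw [renyi_eq ht h1]
  rcases lt_or_gt_of_ne h1 with h | h
  · have h' := toReal_lt_one h
    have := Real.log_le_log (powSum_pos hp _)
      (powSum_le_of_le_one hp (ENNReal.toReal_nonneg (a := α)) h'.le)
    rw [Real.log_rpow hc] at this
    rw [one_div_mul_eq_div, div_le_iff₀ (by linarith)]
    linarith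
  · have h' := one_lt_toReal h ht
    have := Real.log_le_log (Real.rpow_pos_of_pos hc _) (le_powSum_of_one_le hp h'.le)
    rw [Real.log_rpow hc] at this
    rw [one_div_mul_eq_div, div_le_iff_of_neg (by linarith)]
    linarith

lemma integrable_renyi (hp : p ∈ stdSimplex ℝ X) (τ : ProbabilityMeasure ℝ≥0∞) :
    Integrable (fun α => renyi α p) (τ : Measure ℝ≥0∞) := by
  refine Integrable.of_bound (measurable_renyi p).aestronglyMeasurable
    (Real.log (Fintype.card X)) (ae_of_all _ fun α => ?_)
  rw [Real.norm_of_nonneg (renyi_nonneg hp α)]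
  exact renyi_le_log_card hp α

end Basic

/-! ### Rényi entropies of mixtures -/

/-- The relative entropy of the Bernoulli distribution `(l, 1 - l)` with respect to
`(m, 1 - m)`. -/
noncomputable def bernoulliKL (l m : ℝ) : ℝ :=
  l * Real.log (l / m) + (1 - l) * Real.log ((1 - l) / (1 - m))

lemma bernoulliKL_self (m : ℝ) : bernoulliKL m m = 0 := by
  unfold bernoulliKL
  rcases eq_or_ne m 0 with rfl | h0
  · simp
  rcases eq_or_ne (1 - m) 0 with h1 | h1
  · simp [h1, h0]
  · simp [h1, h0]

lemma bernoulliKL_nonneg {l m : ℝ} (hl : l ∈ Ioo (0 : ℝ) 1) (hm : m ∈ Ioo (0 : ℝ) 1) :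
    0 ≤ bernoulliKL l m := by
  have key : ∀ a b : ℝ, 0 < a → 0 < b → a - b ≤ a * Real.log (a / b) := fun a b ha hb => by
    have := Real.log_le_sub_one_of_pos (div_pos hb ha)
    rw [← inv_div, Real.log_inv] at this
    have := mul_le_mul_of_nonneg_left this ha.le
    have e : a * (((a / b))⁻¹ - 1) = b - a := by field_simp
    rw [e] at this
    linarith
  have h1 := key l m hl.1 hm.1
  have h2 := key (1 - l) (1 - m) (by linarith [hl.2]) (by linarith [hm.2])
  unfold bernoulliKL
  linarith

/-- The equality case of the Gibbs variational principle for `log (a + b)`, at the weight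
`a / (a + b)`. -/
lemma log_add_eq {A B m : ℝ} (hA : 0 < A) (hB : 0 < B) (hm : m ∈ Ioo (0 : ℝ) 1) :
    Real.log (m * A + (1 - m) * B) =
      m * A / (m * A + (1 - m) * B) * Real.log A +
        (1 - m * A / (m * A + (1 - m) * B)) * Real.log B -
        bernoulliKL (m * A / (m * A + (1 - m) * B)) m := by
  have hm0 := hm.1
  have hm1 : 0 < 1 - m := by linarith [hm.2]
  set Z := m * A + (1 - m) * B with hZ
  have hZ0 : 0 < Z := by positivity
  have e1 : m * A / Z / m = A / Z := by field_simp
  have e2 : (1 - m * A / Z) / (1 - m) = B / Z := by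
    rw [hZ]; field_simp; ring
  unfold bernoulliKL
  rw [e1, e2, Real.log_div hA.ne' hZ0.ne', Real.log_div hB.ne' hZ0.ne']
  ring

lemma weight_mem_Ioo {A B m : ℝ} (hA : 0 < A) (hB : 0 < B) (hm : m ∈ Ioo (0 : ℝ) 1) :
    m * A / (m * A + (1 - m) * B) ∈ Ioo (0 : ℝ) 1 := by
  have hm0 := hm.1
  have hm1 : 0 < 1 - m := by linarith [hm.2]
  have h1 : 0 < m * A := by positivity
  have h2 : 0 < (1 - m) * B := by positivity
  exact ⟨by positivity, by rw [div_lt_one (by positivity)]; linarith⟩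

/-- The Gibbs variational inequality. -/
lemma exp_sub_bernoulliKL_le {x y l m : ℝ} (hl : l ∈ Ioo (0 : ℝ) 1) (hm : m ∈ Ioo (0 : ℝ) 1) :
    Real.exp (l * x + (1 - l) * y - bernoulliKL l m) ≤
      m * Real.exp x + (1 - m) * Real.exp y := by
  have hl0 := hl.1
  have hl1 : 0 < 1 - l := by linarith [hl.2]
  have hm0 := hm.1
  have hm1 : 0 < 1 - m := by linarith [hm.2]
  have h := convexOn_exp.2 (mem_univ (x - Real.log (l / m)))
    (mem_univ (y - Real.log ((1 - l) / (1 - m)))) hl0.le hl1.le (by ring)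
  simp only [smul_eq_mul, Real.exp_sub] at h
  rw [Real.exp_log (by positivity), Real.exp_log (by positivity)] at h
  refine le_of_eq_of_le ?_ (h.trans_eq ?_)
  · unfold bernoulliKL; congr 1; ring
  · field_simp

section Mixture

/-- The mixture `m p + (1 - m) q`. -/
def mix {X : Type*} (m : ℝ) (p q : X → ℝ) : X → ℝ := m • p + (1 - m) • q

lemma mix_apply {X : Type*} (m : ℝ) (p q : X → ℝ) (x : X) :
    mix m p q x = m * p x + (1 - m) * q x := rfl

variable {X : Type*} [Fintype X] {p q : X → ℝ} {m : ℝ}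

lemma mix_mem (hp : p ∈ stdSimplex ℝ X) (hq : q ∈ stdSimplex ℝ X) (hm : m ∈ Ioo (0 : ℝ) 1) :
    mix m p q ∈ stdSimplex ℝ X :=
  convex_stdSimplex ℝ X hp hq hm.1.le (by linarith [hm.2]) (by ring)

/-- For `α < 1`, every weight `l` is admissible: this is the superadditivity of the `ℓ^α`
quasi-norm, made multiplicatively linear by weights. -/
lemma renyi_mix_of_lt_one (hp : p ∈ stdSimplex ℝ X) (hq : q ∈ stdSimplex ℝ X)
    (hm : m ∈ Ioo (0 : ℝ) 1) {α : ℝ≥0∞} (hα : α < 1) {l : ℝ} (hl : l ∈ Ioo (0 : ℝ) 1) :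
    l * renyi α p + (1 - l) * renyi α q - ratio α * bernoulliKL l m ≤ renyi α (mix m p q) := by
  classical
  have hl0 := hl.1
  have hl1 : 0 < 1 - l := by linarith [hl.2]
  have hm0 := hm.1
  have hm1 : 0 < 1 - m := by linarith [hm.2]
  have hα' := toReal_lt_one hα
  rw [renyi_eq hα.ne_top hα.ne, renyi_eq hα.ne_top hα.ne, renyi_eq hα.ne_top hα.ne,
    ratio_eq hα.ne_top]
  set a := α.toReal with ha
  have ha0 : 0 ≤ a := ENNReal.toReal_nonneg
  have hP := powSum_pos hp a
  have hQ := powSum_pos hq a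
  have key : l * (m / l) ^ a * powSum a p + (1 - l) * ((1 - m) / (1 - l)) ^ a * powSum a q ≤
      powSum a (mix m p q) := by
    rcases ha0.eq_or_lt with h0 | h0
    · rw [← h0]
      have hs : ∀ r : X → ℝ, (∀ x, r x ≠ 0 → mix m p q x ≠ 0) →
          powSum 0 r ≤ powSum 0 (mix m p q) := fun r hr => by
        simp only [powSum, Real.rpow_zero, Finset.sum_const, nsmul_eq_mul, mul_one]
        exact_mod_cast Finset.card_le_card (Finset.monotone_filter_right _ fun x _ => hr x)
      have h1 := hs p fun x hx => by
        have := lt_of_le_of_ne (hp.1 x) (Ne.symm hx)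
        have := hq.1 x
        rw [mix_apply]; positivity
      have h2 := hs q fun x hx => by
        have := lt_of_le_of_ne (hq.1 x) (Ne.symm hx)
        have := hp.1 x
        rw [mix_apply]; positivity
      simp only [Real.rpow_zero, mul_one]
      nlinarith
    · rw [powSum_eq_sum h0.ne', powSum_eq_sum h0.ne', powSum_eq_sum h0.ne', Finset.mul_sum,
        Finset.mul_sum, ← Finset.sum_add_distrib]
      refine Finset.sum_le_sum fun x _ => ?_
      have h := (Real.concaveOn_rpow h0.le hα'.le).2
        (x := m / l * p x) (mem_Ici.2 (mul_nonneg (by positivity) (hp.1 x)))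
        (y := (1 - m) / (1 - l) * q x) (mem_Ici.2 (mul_nonneg (by positivity) (hq.1 x)))
        hl0.le hl1.le (by ring)
      simp only [smul_eq_mul] at h
      rw [Real.mul_rpow (by positivity) (hp.1 x), Real.mul_rpow (by positivity) (hq.1 x)] at h
      rw [mix_apply]
      convert h using 1
      · ring
      · congr 1; field_simp
  have hpos : ∀ c d S : ℝ, 0 < c → 0 < d → 0 < S →
      Real.log ((c / d) ^ a * S) = Real.log S - a * Real.log (d / c) := fun c d S hc hd hS => by
    rw [Real.log_mul (by positivity) hS.ne', Real.log_rpow (by positivity), ← inv_div,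
      Real.log_inv]
    ring
  have h := strictConcaveOn_log_Ioi.concaveOn.2
    (x := (m / l) ^ a * powSum a p) (mem_Ioi.2 (by positivity))
    (y := ((1 - m) / (1 - l)) ^ a * powSum a q) (mem_Ioi.2 (by positivity))
    hl0.le hl1.le (by ring)
  simp only [smul_eq_mul] at h
  rw [hpos _ _ _ hm0 hl0 hP, hpos _ _ _ hm1 hl1 hQ] at h
  have h2 := h.trans (Real.log_le_log (by positivity)
    (by simpa only [mul_assoc] using key))
  have h3 : 0 < 1 - a := by linarith
  have h4 := div_le_div_of_nonneg_right h2 h3.le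
  unfold bernoulliKL
  refine le_of_eq_of_le ?_ (h4.trans_eq ?_)
  · field_simp; ring
  · ring

lemma renyi_mix_one (hp : p ∈ stdSimplex ℝ X) (hq : q ∈ stdSimplex ℝ X)
    (hm : m ∈ Ioo (0 : ℝ) 1) :
    m * renyi 1 p + (1 - m) * renyi 1 q ≤ renyi 1 (mix m p q) := by
  simp only [renyi_one, Finset.mul_sum, ← Finset.sum_add_distrib]
  refine Finset.sum_le_sum fun x _ => ?_
  exact Real.concaveOn_negMulLog.2 (mem_Ici.2 (hp.1 x)) (mem_Ici.2 (hq.1 x)) hm.1.le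
    (by linarith [hm.2]) (by ring)

/-- For `α > 1` the entropy is `ratio α * log N` for a norm `N` on `X → ℝ`. -/
lemma exists_norm_renyi {α : ℝ≥0∞} (hα : 1 < α) (hp : p ∈ stdSimplex ℝ X)
    (hq : q ∈ stdSimplex ℝ X) (hm : m ∈ Ioo (0 : ℝ) 1) :
    ∃ A B C : ℝ, 0 < A ∧ 0 < B ∧ 0 < C ∧ C ≤ m * A + (1 - m) * B ∧
      renyi α p = ratio α * Real.log A ∧ renyi α q = ratio α * Real.log B ∧
      renyi α (mix m p q) = ratio α * Real.log C := by
  have hm0 := hm.1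
  have hm1 : 0 < 1 - m := by linarith [hm.2]
  have hmix := mix_mem hp hq hm
  have := nonempty_of_mem_stdSimplex hp
  by_cases ht : α = ⊤
  · subst ht
    refine ⟨_, _, _, iSup_pos_of_mem_stdSimplex hp, iSup_pos_of_mem_stdSimplex hq,
      iSup_pos_of_mem_stdSimplex hmix, ?_, ?_, ?_, ?_⟩
    · refine ciSup_le fun x => ?_
      rw [mix_apply]
      gcongr
      · exact le_ciSup (Finite.bddAbove_range p) x
      · exact le_ciSup (Finite.bddAbove_range q) x
    all_goals rw [renyi_top, ratio_top]; ring
  · have ha := one_lt_toReal hα ht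
    set a := α.toReal with ha'
    have ha0 : a ≠ 0 := by linarith
    have hpos : ∀ r ∈ stdSimplex ℝ X, 0 < powSum a r ^ (1 / a) := fun r hr =>
      Real.rpow_pos_of_pos (powSum_pos hr a) _
    have hren : ∀ r ∈ stdSimplex ℝ X,
        renyi α r = ratio α * Real.log (powSum a r ^ (1 / a)) := fun r hr => by
      rw [renyi_eq ht hα.ne', ratio_eq ht, Real.log_rpow (powSum_pos hr a), ← ha']
      have : 1 - a ≠ 0 := by linarith
      field_simp
    refine ⟨_, _, _, hpos p hp, hpos q hq, hpos _ hmix, ?_, hren p hp, hren q hq, hren _ hmix⟩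
    have h := Real.Lp_add_le_of_nonneg (s := Finset.univ) (f := fun x => m * p x)
      (g := fun x => (1 - m) * q x) ha.le (fun x _ => mul_nonneg hm0.le (hp.1 x))
      (fun x _ => mul_nonneg hm1.le (hq.1 x))
    have hsc : ∀ c : ℝ, 0 < c → ∀ r ∈ stdSimplex ℝ X,
        (∑ x, (c * r x) ^ a) ^ (1 / a) = c * powSum a r ^ (1 / a) := fun c hc r hr => by
      rw [powSum_eq_sum ha0]
      simp_rw [fun x => Real.mul_rpow hc.le (hr.1 x) (z := a)]
      rw [← Finset.mul_sum, Real.mul_rpow (by positivity)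
        (Finset.sum_nonneg fun x _ => Real.rpow_nonneg (hr.1 x) _), ← Real.rpow_mul hc.le,
        mul_one_div_cancel ha0, Real.rpow_one]
    rw [hsc m hm0 p hp, hsc _ hm1 q hq] at h
    rw [powSum_eq_sum ha0 (mix m p q)]
    exact h

/-- For `α > 1` the entropy is a negative multiple of `log N` for a norm `N`, so that the triangle
inequality for `N` gives a lower bound. The weight is the one at which the logarithm of the right
side of the triangle inequality becomes linear, see `log_add_eq`. -/
lemma exists_renyi_mix_of_one_lt (hp : p ∈ stdSimplex ℝ X) (hq : q ∈ stdSimplex ℝ X)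
    (hm : m ∈ Ioo (0 : ℝ) 1) {α : ℝ≥0∞} (hα : 1 < α) :
    ∃ l ∈ Ioo (0 : ℝ) 1, l * renyi α p + (1 - l) * renyi α q - ratio α * bernoulliKL l m ≤
      renyi α (mix m p q) := by
  obtain ⟨A, B, C, hA, hB, hC, hle, e1, e2, e3⟩ := exists_norm_renyi hα hp hq hm
  refine ⟨_, weight_mem_Ioo hA hB hm, ?_⟩
  rw [e1, e2, e3]
  have h := Real.log_le_log hC hle
  rw [log_add_eq hA hB hm] at h
  have hr := ratio_le_neg_one hα
  have := mul_le_mul_of_nonpos_left h (by linarith : ratio α ≤ 0)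
  linarith

end Mixture

/-! ### Conditionally mixing channels and functions on the simplex -/

section Channel

variable {X Y Y' : Type*} [Fintype X] [DecidableEq X] [Fintype Y] [Fintype Y']

omit [DecidableEq X] [Fintype Y] in
lemma marginal_mul_conditional {P : Matrix X Y ℝ} (hP : ∀ x y, 0 ≤ P x y) (x : X) (y : Y) :
    marginal P y * conditional P y x = P x y := by
  unfold conditional
  rcases eq_or_ne (marginal P y) 0 with h | h
  · have := (Finset.sum_eq_zero_iff_of_nonneg fun x _ => hP x y).1 h x (Finset.mem_univ x)
    rw [h, this, zero_mul]
  · exact mul_div_cancel₀ _ h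

omit [DecidableEq X] [Fintype Y] in
lemma marginal_nonneg {P : Matrix X Y ℝ} (hP : ∀ x y, 0 ≤ P x y) (y : Y) : 0 ≤ marginal P y :=
  Finset.sum_nonneg fun x _ => hP x y

omit [DecidableEq X] [Fintype Y] in
lemma conditional_mem {P : Matrix X Y ℝ} (hP : ∀ x y, 0 ≤ P x y) {y : Y}
    (hy : marginal P y ≠ 0) : conditional P y ∈ stdSimplex ℝ X := by
  refine ⟨fun x => div_nonneg (hP x y) (marginal_nonneg hP y), ?_⟩
  unfold conditional
  rw [← Finset.sum_div]
  exact div_self hy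

/-- Birkhoff's theorem: the image of `p` under a doubly stochastic matrix is a convex combination
of rearrangements of `p`. -/
lemma mulVec_mem_convexHull {S : Matrix X X ℝ} (hS : S ∈ doublyStochastic ℝ X) (p : X → ℝ) :
    S *ᵥ p ∈ convexHull ℝ (range fun σ : Equiv.Perm X => p ∘ σ) := by
  obtain ⟨w, hw0, hw1, rfl⟩ := exists_eq_sum_perm_of_mem_doublyStochastic hS
  rw [Matrix.sum_mulVec]
  simp only [Matrix.smul_mulVec, Matrix.permMatrix_mulVec]
  exact (convex_convexHull ℝ _).sum_mem (fun σ _ => hw0 σ) hw1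
    fun σ _ => subset_convexHull ℝ _ ⟨σ, rfl⟩

omit [DecidableEq X] in
lemma comp_perm_mem {p : X → ℝ} (hp : p ∈ stdSimplex ℝ X) (σ : Equiv.Perm X) :
    p ∘ σ ∈ stdSimplex ℝ X :=
  ⟨fun x => hp.1 (σ x), by rw [← hp.2]; exact Equiv.sum_comp σ p⟩

/-- A conditionally mixing channel writes the columns of the output as nonnegative combinations of
doubly stochastic images of the conditional distributions of the input, whose weights have the
input marginal as their total. -/
lemma CondMixes.exists_weights {P : Matrix X Y ℝ} {Q : Matrix X Y' ℝ} (hP : IsProb P)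
    (h : CondMixes P Q) :
    ∃ (k : ℕ) (S : Fin k → Matrix X X ℝ) (w : Fin k × Y → Y' → ℝ),
      (∀ i, S i ∈ doublyStochastic ℝ X) ∧ (∀ j y', 0 ≤ w j y') ∧
      (∀ j y', w j y' ≠ 0 → marginal P j.2 ≠ 0) ∧
      (∀ x y', Q x y' = ∑ j, w j y' * (S j.1 *ᵥ conditional P j.2) x) ∧
      (∀ y, ∑ i, ∑ y', w (i, y) y' = marginal P y) ∧
      (∀ y', marginal Q y' = ∑ j, w j y') := by
  obtain ⟨k, S, D, hS, hD, hD1, rfl⟩ := h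
  have hQ : ∀ x y', (∑ i, S i * P * D i) x y' =
      ∑ j : Fin k × Y, D j.1 j.2 y' * marginal P j.2 * (S j.1 *ᵥ conditional P j.2) x := by
    intro x y'
    rw [Matrix.sum_apply, Fintype.sum_prod_type]
    refine Finset.sum_congr rfl fun i _ => ?_
    rw [Matrix.mul_apply]
    refine Finset.sum_congr rfl fun y _ => ?_
    rw [Matrix.mul_apply, mul_comm, mul_assoc]
    congr 1
    rw [Matrix.mulVec, dotProduct, Finset.mul_sum]
    refine Finset.sum_congr rfl fun z _ => ?_
    rw [← marginal_mul_conditional hP.1 z y]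
    ring
  refine ⟨k, S, fun j y' => D j.1 j.2 y' * marginal P j.2, hS,
    fun j y' => mul_nonneg ((hD _).1 _ _) (marginal_nonneg hP.1 _),
    fun j y' h => right_ne_zero_of_mul h, hQ, fun y => ?_, fun y' => ?_⟩
  · have := hD1.2 y
    simp only [Matrix.sum_apply] at this
    rw [Finset.sum_comm] at this
    simp only [← Finset.sum_mul]
    rw [this, one_mul]
  · change ∑ x, (∑ i, S i * P * D i) x y' = _
    simp only [hQ]
    rw [Finset.sum_comm]
    refine Finset.sum_congr rfl fun j _ => ?_
    rw [← Finset.mul_sum, sum_mulVec_of_mem_doublyStochastic (hS _)]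
    rcases eq_or_ne (marginal P j.2) 0 with h0 | h0
    · simp [h0]
    · rw [(conditional_mem hP.1 h0).2, mul_one]

omit [DecidableEq X] [Fintype Y] [Fintype Y'] in
/-- A column written as a nonnegative combination is, after normalization, a centre of mass. -/
lemma conditional_eq_centerMass {ι : Type*} [Fintype ι] {Q : Matrix X Y' ℝ} {y' : Y'}
    {w : ι → ℝ} {z : ι → X → ℝ} (hQ : ∀ x, Q x y' = ∑ j, w j * z j x)
    (hm : marginal Q y' = ∑ j, w j) :
    conditional Q y' = (Finset.univ.filter fun j => w j ≠ 0).centerMass w z := by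
  classical
  rw [Finset.centerMass_filter_ne_zero, Finset.centerMass]
  ext x
  simp [conditional, hQ, hm, Finset.sum_apply, div_eq_inv_mul]

/-- Monotonicity under conditionally mixing channels of the average over `y` of a symmetric
concave function of `P_{X|Y=y}`. -/
theorem CondMixes.sum_marginal_mul_le {P : Matrix X Y ℝ} {Q : Matrix X Y' ℝ} (hP : IsProb P)
    (h : CondMixes P Q) {G : (X → ℝ) → ℝ} (hG : ConcaveOn ℝ (stdSimplex ℝ X) G)
    (hsymm : ∀ p (σ : Equiv.Perm X), G (p ∘ σ) = G p) :
    ∑ y, marginal P y * G (conditional P y) ≤ ∑ y', marginal Q y' * G (conditional Q y') := by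
  classical
  obtain ⟨k, S, w, hS, hw, hw0, hQ, hwP, hwQ⟩ := h.exists_weights hP
  have hmem : ∀ j y', w j y' ≠ 0 → S j.1 *ᵥ conditional P j.2 ∈ stdSimplex ℝ X ∧
      G (conditional P j.2) ≤ G (S j.1 *ᵥ conditional P j.2) := fun j y' hj => by
    have hc := conditional_mem hP.1 (hw0 j y' hj)
    have hsub : (range fun σ : Equiv.Perm X => conditional P j.2 ∘ σ) ⊆ stdSimplex ℝ X := by
      rintro _ ⟨σ, rfl⟩
      exact comp_perm_mem hc σ
    have hS' := mulVec_mem_convexHull (hS j.1) (conditional P j.2)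
    refine ⟨convexHull_min hsub (convex_stdSimplex ℝ X) hS', ?_⟩
    obtain ⟨_, ⟨σ, rfl⟩, hσ⟩ := hG.exists_le_of_mem_convexHull hsub hS'
    rwa [hsymm] at hσ
  have hy' : ∀ y', ∑ j, w j y' * G (conditional P j.2) ≤
      marginal Q y' * G (conditional Q y') := fun y' => by
    rw [conditional_eq_centerMass (fun x => hQ x y') (hwQ y'), hwQ]
    have hsum : (∑ j with w j y' ≠ 0, w j y') = ∑ j, w j y' := Finset.sum_filter_ne_zero _
    rcases (Finset.sum_nonneg fun j (_ : j ∈ Finset.univ) => hw j y').eq_or_lt with h0 | h0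
    · have hz := (Finset.sum_eq_zero_iff_of_nonneg fun j _ => hw j y').1 h0.symm
      rw [← h0, zero_mul]
      exact (Finset.sum_eq_zero fun j hj => by rw [hz j hj, zero_mul]).le
    · have := hG.le_map_centerMass (t := Finset.univ.filter fun j => w j y' ≠ 0)
        (w := fun j => w j y') (p := fun j => S j.1 *ᵥ conditional P j.2)
        (fun j _ => hw j y') (by rwa [hsum]) fun j hj => (hmem j y' (Finset.mem_filter.1 hj).2).1
      refine le_trans ?_ (mul_le_mul_of_nonneg_left this h0.le)
      rw [Finset.centerMass, hsum, smul_eq_mul, mul_inv_cancel_left₀ h0.ne', Finset.sum_filter]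
      refine Finset.sum_le_sum fun j _ => ?_
      split_ifs with hj
      · exact mul_le_mul_of_nonneg_left (hmem j y' hj).2 (hw j y')
      · rw [not_not.1 hj, zero_mul]
  calc ∑ y, marginal P y * G (conditional P y)
      = ∑ y', ∑ j, w j y' * G (conditional P j.2) := by
        rw [Finset.sum_comm, Fintype.sum_prod_type, Finset.sum_comm]
        refine Finset.sum_congr rfl fun y _ => ?_
        rw [← hwP, Finset.sum_mul]
        exact Finset.sum_congr rfl fun i _ => Finset.sum_mul _ _ _
    _ ≤ _ := Finset.sum_le_sum fun y' _ => hy' y'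

/-- Under a conditionally mixing channel, a symmetric quasiconcave function that is at least `r` on
every conditional distribution of the input is at least `r` on those of the output. -/
theorem CondMixes.le_conditional {P : Matrix X Y ℝ} {Q : Matrix X Y' ℝ} (hP : IsProb P)
    (h : CondMixes P Q) {F : (X → ℝ) → ℝ} (hF : QuasiconcaveOn ℝ (stdSimplex ℝ X) F)
    (hsymm : ∀ p (σ : Equiv.Perm X), F (p ∘ σ) = F p) {r : ℝ}
    (hr : ∀ y, 0 < marginal P y → r ≤ F (conditional P y)) {y' : Y'} (hy' : 0 < marginal Q y') :
    r ≤ F (conditional Q y') := by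
  classical
  obtain ⟨k, S, w, hS, hw, hw0, hQ, hwP, hwQ⟩ := h.exists_weights hP
  rw [conditional_eq_centerMass (fun x => hQ x y') (hwQ y')]
  have hsum : (∑ j with w j y' ≠ 0, w j y') = ∑ j, w j y' := Finset.sum_filter_ne_zero _
  refine ((hF r).centerMass_mem (t := Finset.univ.filter fun j => w j y' ≠ 0)
    (w := fun j => w j y') (z := fun j => S j.1 *ᵥ conditional P j.2)
    (fun j _ => hw j y') (by rwa [hsum, ← hwQ]) fun j hj => ?_).2
  have hj' := hw0 j y' (Finset.mem_filter.1 hj).2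
  refine convexHull_min ?_ (hF r) (mulVec_mem_convexHull (hS j.1) (conditional P j.2))
  rintro _ ⟨σ, rfl⟩
  refine ⟨comp_perm_mem (conditional_mem hP.1 hj') σ, ?_⟩
  rw [hsymm]
  exact hr _ (lt_of_le_of_ne (marginal_nonneg hP.1 _) hj'.symm)

end Channel

/-! ### Averaged entropies: sufficiency -/

section Sufficiency

variable {X : Type*} [Fintype X] {p q : X → ℝ} {m : ℝ} {τ : ProbabilityMeasure ℝ≥0∞}

lemma renyi_comp_perm (α : ℝ≥0∞) (p : X → ℝ) (σ : Equiv.Perm X) :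
    renyi α (p ∘ σ) = renyi α p := by
  by_cases ht : α = ⊤
  · subst ht
    rw [renyi_top, renyi_top]
    congr 2
    exact σ.iSup_comp (g := p)
  by_cases h1 : α = 1
  · subst h1
    rw [renyi_one, renyi_one]
    exact Equiv.sum_comp σ fun x => Real.negMulLog (p x)
  · rw [renyi_eq ht h1, renyi_eq ht h1]
    congr 2
    unfold powSum
    rw [Finset.sum_filter, Finset.sum_filter]
    exact Equiv.sum_comp σ fun x => if p x ≠ 0 then p x ^ α.toReal else 0

lemma avgRenyi_comp_perm (p : X → ℝ) (σ : Equiv.Perm X) :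
    avgRenyi τ (p ∘ σ) = avgRenyi τ p := by
  simp [avgRenyi, renyi_comp_perm]

lemma avgRenyi_mix (hp : p ∈ stdSimplex ℝ X) (hq : q ∈ stdSimplex ℝ X) (hm : m ∈ Ioo (0 : ℝ) 1)
    {l : ℝ} (hτ : Integrable ratio (τ : Measure ℝ≥0∞))
    (h : ∀ᵐ α ∂(τ : Measure ℝ≥0∞),
      l * renyi α p + (1 - l) * renyi α q - ratio α * bernoulliKL l m ≤ renyi α (mix m p q)) :
    l * avgRenyi τ p + (1 - l) * avgRenyi τ q -
      (∫ α, ratio α ∂(τ : Measure ℝ≥0∞)) * bernoulliKL l m ≤ avgRenyi τ (mix m p q) := by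
  have ip := (integrable_renyi hp τ).const_mul l
  have iq := (integrable_renyi hq τ).const_mul (1 - l)
  have ir := hτ.mul_const (bernoulliKL l m)
  have := integral_mono_ae ((ip.add iq).sub ir) (integrable_renyi (mix_mem hp hq hm) τ) h
  rw [integral_sub' (ip.add iq) ir, integral_add' ip iq, integral_const_mul, integral_const_mul,
    integral_mul_const] at this
  exact this

lemma avgRenyi_mix_of_ae_le_one (hp : p ∈ stdSimplex ℝ X) (hq : q ∈ stdSimplex ℝ X)
    (hm : m ∈ Ioo (0 : ℝ) 1) (hτ : ∀ᵐ α ∂(τ : Measure ℝ≥0∞), α ≤ 1) :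
    m * avgRenyi τ p + (1 - m) * avgRenyi τ q ≤ avgRenyi τ (mix m p q) := by
  have ip := (integrable_renyi hp τ).const_mul m
  have iq := (integrable_renyi hq τ).const_mul (1 - m)
  have := integral_mono_ae (ip.add iq) (integrable_renyi (mix_mem hp hq hm) τ) (by
    filter_upwards [hτ] with α hα
    rcases hα.eq_or_lt with rfl | h
    · exact renyi_mix_one hp hq hm
    · simpa [bernoulliKL_self] using renyi_mix_of_lt_one hp hq hm h hm)
  rw [integral_add' ip iq, integral_const_mul, integral_const_mul] at this
  exact this

lemma concaveOn_of_mix {G : (X → ℝ) → ℝ}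
    (h : ∀ p ∈ stdSimplex ℝ X, ∀ q ∈ stdSimplex ℝ X, ∀ m ∈ Ioo (0 : ℝ) 1,
      m * G p + (1 - m) * G q ≤ G (mix m p q)) : ConcaveOn ℝ (stdSimplex ℝ X) G := by
  refine concaveOn_iff_forall_pos.2 ⟨convex_stdSimplex ℝ X, fun p hp q hq a b ha hb hab => ?_⟩
  obtain rfl : b = 1 - a := by linarith
  exact h p hp q hq a ⟨ha, by linarith⟩

/-- When `τ` lives on `[0,1) ∪ {a}` with `a > 1`, some weight serves for all orders at once. -/
lemma exists_avgRenyi_mix (hp : p ∈ stdSimplex ℝ X) (hq : q ∈ stdSimplex ℝ X)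
    (hm : m ∈ Ioo (0 : ℝ) 1) (hint : Integrable ratio (τ : Measure ℝ≥0∞)) {a : ℝ≥0∞} (ha : 1 < a)
    (hτ : ∀ᵐ α ∂(τ : Measure ℝ≥0∞), α < 1 ∨ α = a) :
    ∃ l ∈ Ioo (0 : ℝ) 1, l * avgRenyi τ p + (1 - l) * avgRenyi τ q -
      (∫ α, ratio α ∂(τ : Measure ℝ≥0∞)) * bernoulliKL l m ≤ avgRenyi τ (mix m p q) := by
  obtain ⟨l, hl, h⟩ := exists_renyi_mix_of_one_lt hp hq hm ha
  refine ⟨l, hl, avgRenyi_mix hp hq hm hint ?_⟩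
  filter_upwards [hτ] with α hα
  rcases hα with hα | rfl
  · exact renyi_mix_of_lt_one hp hq hm hα hl
  · exact h

lemma concaveOn_exp_avgRenyi {t : ℝ} (ht : 0 < t) (hint : Integrable ratio (τ : Measure ℝ≥0∞))
    (hI : ∫ α, ratio α ∂(τ : Measure ℝ≥0∞) ≤ 1 / t)
    (hτ : ∀ᵐ α ∂(τ : Measure ℝ≥0∞), α < 1) :
    ConcaveOn ℝ (stdSimplex ℝ X) fun p => Real.exp (t * avgRenyi τ p) := by
  refine concaveOn_of_mix fun p hp q hq m hm => ?_
  -- The weight is chosen to attain equality in the Gibbs variational inequality.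
  have hA := Real.exp_pos (t * avgRenyi τ p)
  have hB := Real.exp_pos (t * avgRenyi τ q)
  have hl := weight_mem_Ioo hA hB hm
  have hlog := log_add_eq hA hB hm
  rw [Real.log_exp, Real.log_exp] at hlog
  set l := m * Real.exp (t * avgRenyi τ p) /
    (m * Real.exp (t * avgRenyi τ p) + (1 - m) * Real.exp (t * avgRenyi τ q))
  have h := avgRenyi_mix hp hq hm (l := l) hint (by
    filter_upwards [hτ] with α hα using renyi_mix_of_lt_one hp hq hm hα hl)
  have hm0 := hm.1
  have hm1 : 0 < 1 - m := by linarith [hm.2]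
  rw [← Real.log_le_iff_le_exp (by positivity), hlog]
  have h1 := mul_le_mul_of_nonneg_left h ht.le
  have h2 : t * (∫ α, ratio α ∂(τ : Measure ℝ≥0∞)) ≤ 1 := by
    rwa [le_div_iff₀ ht, mul_comm] at hI
  have h3 := mul_le_mul_of_nonneg_right h2 (bernoulliKL_nonneg hl hm)
  linarith

lemma concaveOn_neg_exp_avgRenyi_of_ae_le_one {t : ℝ} (ht : t < 0)
    (hτ : ∀ᵐ α ∂(τ : Measure ℝ≥0∞), α ≤ 1) :
    ConcaveOn ℝ (stdSimplex ℝ X) fun p => -Real.exp (t * avgRenyi τ p) := by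
  refine concaveOn_of_mix fun p hp q hq m hm => ?_
  have h := mul_le_mul_of_nonpos_left (avgRenyi_mix_of_ae_le_one hp hq hm hτ) ht.le
  have h2 := exp_sub_bernoulliKL_le (x := t * avgRenyi τ p) (y := t * avgRenyi τ q) hm hm
  rw [bernoulliKL_self] at h2
  have h3 := Real.exp_le_exp.2 (show t * avgRenyi τ (mix m p q) ≤
    m * (t * avgRenyi τ p) + (1 - m) * (t * avgRenyi τ q) - 0 by linarith)
  linarith

lemma concaveOn_neg_exp_avgRenyi {t : ℝ} (ht : t < 0)
    (hint : Integrable ratio (τ : Measure ℝ≥0∞))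
    (hI : ∫ α, ratio α ∂(τ : Measure ℝ≥0∞) ≤ 1 / t) {a : ℝ≥0∞} (ha : 1 < a)
    (hτ : ∀ᵐ α ∂(τ : Measure ℝ≥0∞), α < 1 ∨ α = a) :
    ConcaveOn ℝ (stdSimplex ℝ X) fun p => -Real.exp (t * avgRenyi τ p) := by
  refine concaveOn_of_mix fun p hp q hq m hm => ?_
  obtain ⟨l, hl, h⟩ := exists_avgRenyi_mix hp hq hm hint ha hτ
  have h1 := mul_le_mul_of_nonpos_left h ht.le
  have h2 := exp_sub_bernoulliKL_le (x := t * avgRenyi τ p) (y := t * avgRenyi τ q) hl hm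
  have h3 : 1 ≤ t * (∫ α, ratio α ∂(τ : Measure ℝ≥0∞)) := by
    rwa [le_div_iff_of_neg ht, mul_comm] at hI
  have h4 := mul_le_mul_of_nonneg_right h3 (bernoulliKL_nonneg hl hm)
  have h5 := Real.exp_le_exp.2 (show t * avgRenyi τ (mix m p q) ≤
    l * (t * avgRenyi τ p) + (1 - l) * (t * avgRenyi τ q) - bernoulliKL l m by linarith)
  linarith

lemma quasiconcaveOn_of_mix {F : (X → ℝ) → ℝ}
    (h : ∀ p ∈ stdSimplex ℝ X, ∀ q ∈ stdSimplex ℝ X, ∀ m ∈ Ioo (0 : ℝ) 1,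
      ∃ l ∈ Ioo (0 : ℝ) 1, l * F p + (1 - l) * F q ≤ F (mix m p q)) :
    QuasiconcaveOn ℝ (stdSimplex ℝ X) F := by
  refine fun r => convex_iff_forall_pos.2 fun p hp q hq a b ha hb hab => ?_
  obtain rfl : b = 1 - a := by linarith
  refine ⟨convex_stdSimplex ℝ X hp.1 hq.1 ha.le hb.le hab, ?_⟩
  obtain ⟨l, hl, hle⟩ := h p hp.1 q hq.1 a ⟨ha, by linarith⟩
  have h1 := mul_le_mul_of_nonneg_left hp.2 hl.1.le
  have h2 := mul_le_mul_of_nonneg_left hq.2 (sub_nonneg.2 hl.2.le)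
  exact le_trans (by linarith) hle

lemma quasiconcaveOn_avgRenyi_of_ae_le_one (hτ : ∀ᵐ α ∂(τ : Measure ℝ≥0∞), α ≤ 1) :
    QuasiconcaveOn ℝ (stdSimplex ℝ X) (avgRenyi τ) :=
  quasiconcaveOn_of_mix fun _ hp _ hq m hm => ⟨m, hm, avgRenyi_mix_of_ae_le_one hp hq hm hτ⟩

lemma quasiconcaveOn_avgRenyi (hint : Integrable ratio (τ : Measure ℝ≥0∞))
    (hI : ∫ α, ratio α ∂(τ : Measure ℝ≥0∞) ≤ 0) {a : ℝ≥0∞} (ha : 1 < a)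
    (hτ : ∀ᵐ α ∂(τ : Measure ℝ≥0∞), α < 1 ∨ α = a) :
    QuasiconcaveOn ℝ (stdSimplex ℝ X) (avgRenyi τ) := by
  refine quasiconcaveOn_of_mix fun p hp q hq m hm => ?_
  obtain ⟨l, hl, h⟩ := exists_avgRenyi_mix hp hq hm hint ha hτ
  have := mul_le_mul_of_nonneg_right hI (bernoulliKL_nonneg hl hm)
  exact ⟨l, hl, by linarith⟩

end Sufficiency

/-! ### Supports and the integral of `α / (1 - α)` -/

section Ratio

variable {τ : ProbabilityMeasure ℝ≥0∞}

lemma ae_mem_of_support_subset {s : Set ℝ≥0∞} (h : (τ : Measure ℝ≥0∞).support ⊆ s) :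
    ∀ᵐ α ∂(τ : Measure ℝ≥0∞), α ∈ s :=
  Filter.mem_of_superset Measure.support_mem_ae h

lemma ratioIntegral_eq (hint : Integrable ratio (τ : Measure ℝ≥0∞))
    (h1 : (τ : Measure ℝ≥0∞) {1} = 0) :
    ratioIntegral τ = ((∫ α, ratio α ∂(τ : Measure ℝ≥0∞) : ℝ) : EReal) := by
  rw [ratioIntegral, if_pos h1, integral_eq_lintegral_pos_part_sub_lintegral_neg_part hint,
    EReal.coe_sub, EReal.coe_ennreal_toReal, EReal.coe_ennreal_toReal]
  · exact hint.neg.lintegral_lt_top.ne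
  · exact hint.lintegral_lt_top.ne

/-- If `ratio` is bounded below almost everywhere and its extended integral is at most a real
number, then it is integrable. -/
lemma integrable_ratio_of_ratioIntegral_le {x c : ℝ}
    (hc : ∀ᵐ α ∂(τ : Measure ℝ≥0∞), -c ≤ ratio α) (h : ratioIntegral τ ≤ (x : EReal)) :
    (τ : Measure ℝ≥0∞) {1} = 0 ∧ Integrable ratio (τ : Measure ℝ≥0∞) ∧
      ∫ α, ratio α ∂(τ : Measure ℝ≥0∞) ≤ x := by
  have h1 : (τ : Measure ℝ≥0∞) {1} = 0 := by
    by_contra h1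
    rw [ratioIntegral, if_neg h1] at h
    exact (EReal.coe_lt_top x).not_ge h
  have hneg : ∫⁻ α, ENNReal.ofReal (-ratio α) ∂(τ : Measure ℝ≥0∞) ≠ ⊤ := by
    refine ne_top_of_le_ne_top (b := ENNReal.ofReal c) ENNReal.ofReal_ne_top ?_
    calc _ ≤ ∫⁻ _, ENNReal.ofReal c ∂(τ : Measure ℝ≥0∞) := lintegral_mono_ae (by
          filter_upwards [hc] with α hα using ENNReal.ofReal_le_ofReal (by linarith))
      _ = _ := by simp
  have hpos : ∫⁻ α, ENNReal.ofReal (ratio α) ∂(τ : Measure ℝ≥0∞) ≠ ⊤ := by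
    intro htop
    rw [ratioIntegral, if_pos h1, htop, ← EReal.coe_ennreal_toReal hneg] at h
    simp at h
  have hint : Integrable ratio (τ : Measure ℝ≥0∞) := by
    refine ⟨measurable_ratio.aestronglyMeasurable, ?_⟩
    rw [hasFiniteIntegral_iff_enorm]
    have e : ∀ α, ‖ratio α‖ₑ = ENNReal.ofReal (ratio α) + ENNReal.ofReal (-ratio α) := fun α => by
      rw [Real.enorm_eq_ofReal_abs]
      rcases le_total 0 (ratio α) with h | h
      · rw [abs_of_nonneg h, ENNReal.ofReal_of_nonpos (neg_nonpos.2 h), add_zero]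
      · rw [abs_of_nonpos h, ENNReal.ofReal_of_nonpos h, zero_add]
    simp only [e]
    rw [lintegral_add_left measurable_ratio.ennreal_ofReal]
    exact ENNReal.add_lt_top.2 ⟨hpos.lt_top, hneg.lt_top⟩
  refine ⟨h1, hint, ?_⟩
  rw [ratioIntegral_eq hint h1] at h
  exact_mod_cast h

lemma integrable_of_ratioIntegral_le {x : ℝ} {a : ℝ≥0∞} (ha : 1 < a)
    (hs : (τ : Measure ℝ≥0∞).support ⊆ Icc 0 1 ∪ {a}) (h : ratioIntegral τ ≤ (x : EReal)) :
    Integrable ratio (τ : Measure ℝ≥0∞) ∧ ∫ α, ratio α ∂(τ : Measure ℝ≥0∞) ≤ x ∧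
      ∀ᵐ α ∂(τ : Measure ℝ≥0∞), α < 1 ∨ α = a := by
  have hae := ae_mem_of_support_subset hs
  have hra := ratio_le_neg_one ha
  obtain ⟨h1, hint, hle⟩ := integrable_ratio_of_ratioIntegral_le (c := -ratio a) (by
    filter_upwards [hae] with α hα
    rw [neg_neg]
    rcases hα with ⟨-, hα⟩ | rfl
    · rcases hα.eq_or_lt with rfl | hα
      · rw [ratio_one]; linarith
      · linarith [ratio_nonneg hα]
    · exact le_rfl) h
  refine ⟨hint, hle, ?_⟩
  have h1' : ∀ᵐ α ∂(τ : Measure ℝ≥0∞), α ≠ 1 := by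
    rw [ae_iff]; simpa using h1
  filter_upwards [hae, h1'] with α hα hα1
  exact hα.imp (fun h => lt_of_le_of_ne h.2 hα1) id

lemma FiniteRatioIntegrals.integrable (h : FiniteRatioIntegrals τ) :
    Integrable ratio (τ : Measure ℝ≥0∞) := by
  have h1 : IntegrableOn ratio {1} (τ : Measure ℝ≥0∞) :=
    integrableOn_singleton (by simp)
  have := (h.1.union h1).union h.2
  rwa [show Ico (0 : ℝ≥0∞) 1 ∪ {1} ∪ Ioc 1 ⊤ = univ by
    ext α
    simp only [mem_union, mem_Ico, mem_singleton_iff, mem_Ioc, mem_univ, iff_true]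
    rcases lt_trichotomy α 1 with h | h | h
    · exact Or.inl (Or.inl ⟨zero_le, h⟩)
    · exact Or.inl (Or.inr h)
    · exact Or.inr ⟨h, le_top⟩, integrableOn_univ] at this

lemma finiteRatioIntegrals_of_finite_support (h : (τ : Measure ℝ≥0∞).support.Finite) :
    FiniteRatioIntegrals τ := by
  obtain ⟨c, hc⟩ := (h.image fun α => ‖ratio α‖).bddAbove
  have hint : Integrable ratio (τ : Measure ℝ≥0∞) := by
    refine Integrable.of_bound measurable_ratio.aestronglyMeasurable c ?_
    filter_upwards [ae_mem_of_support_subset (τ := τ) subset_rfl] with α hα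
    exact hc ⟨α, hα, rfl⟩
  exact ⟨hint.integrableOn, hint.integrableOn⟩

end Ratio

/-! ### Monotonicity -/

section Monotone

variable {τ : ProbabilityMeasure ℝ≥0∞} {X Y Y' : Type} [Fintype X] [DecidableEq X] [Fintype Y]
  [Fintype Y'] {P : Matrix X Y ℝ} {Q : Matrix X Y' ℝ}

omit [DecidableEq X] in
lemma sum_marginal_eq (P : Matrix X Y ℝ) : ∑ y, marginal P y = ∑ x, ∑ y, P x y :=
  Finset.sum_comm

omit [DecidableEq X] in
lemma IsProb.sum_marginal (hP : IsProb P) : ∑ y, marginal P y = 1 :=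
  (sum_marginal_eq P).trans hP.2

omit [DecidableEq X] in
lemma IsProb.exists_marginal_pos (hP : IsProb P) : ∃ y, 0 < marginal P y := by
  by_contra! h
  have := Finset.sum_nonpos fun y (_ : y ∈ Finset.univ) => h y
  rw [hP.sum_marginal] at this
  linarith

omit [DecidableEq X] in
lemma IsProb.sum_marginal_mul_exp_pos (hP : IsProb P) (f : Y → ℝ) :
    0 < ∑ y, marginal P y * Real.exp (f y) := by
  obtain ⟨y, hy⟩ := hP.exists_marginal_pos
  exact Finset.sum_pos' (fun y _ => mul_nonneg (marginal_nonneg hP.1 y) (Real.exp_pos _).le)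
    ⟨y, Finset.mem_univ y, mul_pos hy (Real.exp_pos _)⟩

lemma CondMixes.isProb (hP : IsProb P) (h : CondMixes P Q) : IsProb Q := by
  obtain ⟨k, S, w, hS, hw, hw0, hQ, hwP, hwQ⟩ := h.exists_weights hP
  refine ⟨fun x y' => ?_, ?_⟩
  · rw [hQ]
    refine Finset.sum_nonneg fun j _ => mul_nonneg (hw j y') (Finset.sum_nonneg fun z _ => ?_)
    exact mul_nonneg (nonneg_of_mem_doublyStochastic (hS _))
      (div_nonneg (hP.1 _ _) (marginal_nonneg hP.1 _))
  · rw [← sum_marginal_eq]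
    simp only [hwQ]
    rw [Finset.sum_comm, Fintype.sum_prod_type, Finset.sum_comm]
    simp only [hwP]
    exact hP.sum_marginal

lemma condEntropy_mono_of_pos {t : ℝ} (ht : 0 < t)
    (hG : ConcaveOn ℝ (stdSimplex ℝ X) fun p => Real.exp (t * avgRenyi τ p))
    (hP : IsProb P) (h : CondMixes P Q) : condEntropy t τ P ≤ condEntropy t τ Q := by
  have := h.sum_marginal_mul_le hP hG fun p σ => by rw [avgRenyi_comp_perm]
  exact mul_le_mul_of_nonneg_left (Real.log_le_log (hP.sum_marginal_mul_exp_pos _) this)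
    (one_div_pos.2 ht).le

lemma condEntropy_mono_of_neg {t : ℝ} (ht : t < 0)
    (hG : ConcaveOn ℝ (stdSimplex ℝ X) fun p => -Real.exp (t * avgRenyi τ p))
    (hP : IsProb P) (h : CondMixes P Q) : condEntropy t τ P ≤ condEntropy t τ Q := by
  have := h.sum_marginal_mul_le hP hG fun p σ => by rw [avgRenyi_comp_perm]
  simp only [mul_neg, Finset.sum_neg_distrib, neg_le_neg_iff] at this
  exact mul_le_mul_of_nonpos_left
    (Real.log_le_log ((h.isProb hP).sum_marginal_mul_exp_pos _) this) (one_div_neg.2 ht).le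

lemma condEntropyNegInfty_mono
    (hF : QuasiconcaveOn ℝ (stdSimplex ℝ X) (avgRenyi τ : (X → ℝ) → ℝ))
    (hP : IsProb P) (h : CondMixes P Q) :
    condEntropyNegInfty τ P ≤ condEntropyNegInfty τ Q := by
  obtain ⟨y, hy⟩ := (h.isProb hP).exists_marginal_pos
  have : Nonempty {y : Y' // 0 < marginal Q y} := ⟨⟨y, hy⟩⟩
  refine le_ciInf fun y' => h.le_conditional hP hF avgRenyi_comp_perm (fun y hy => ?_) y'.2
  exact ciInf_le (f := fun y : {y : Y // 0 < marginal P y} => avgRenyi τ (conditional P y))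
    (Finite.bddBelow_range _) ⟨y, hy⟩

end Monotone

theorem DbulkTilde_subset : DbulkTilde ⊆ Dbulk := by
  rintro ⟨t, τ⟩ (⟨ht, hs, hI⟩ | ⟨ht, hs | ⟨a, ha, hs, hI⟩⟩)
  · refine ⟨ht.ne', fun X Y Y' _ _ _ _ P Q hP h => ?_⟩
    -- Here `τ` does not charge `(1,∞]`, and any `a > 1` may serve as the exceptional order.
    obtain ⟨hint, hle, hae⟩ := integrable_of_ratioIntegral_le (a := ⊤) ENNReal.one_lt_top
      (hs.trans subset_union_left) hI
    refine condEntropy_mono_of_pos ht (concaveOn_exp_avgRenyi ht hint hle ?_) hP h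
    filter_upwards [hae, ae_mem_of_support_subset hs] with α h1 h2
    refine h1.resolve_right fun h => ?_
    rw [h] at h2
    exact ENNReal.one_lt_top.not_ge h2.2
  · exact ⟨ht.ne, fun X Y Y' _ _ _ _ P Q hP h => condEntropy_mono_of_neg ht
      (concaveOn_neg_exp_avgRenyi_of_ae_le_one ht
        ((ae_mem_of_support_subset hs).mono fun α h => h.2)) hP h⟩
  · obtain ⟨hint, hle, hae⟩ := integrable_of_ratioIntegral_le ha hs hI
    exact ⟨ht.ne, fun X Y Y' _ _ _ _ P Q hP h => condEntropy_mono_of_neg ht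
      (concaveOn_neg_exp_avgRenyi ht hint hle ha hae) hP h⟩

theorem DnegInftyTilde_subset : DnegInftyTilde ⊆ DnegInfty := by
  rintro τ (hs | ⟨a, ha, hs, hI⟩) X Y Y' _ _ _ _ P Q hP h
  · exact condEntropyNegInfty_mono (quasiconcaveOn_avgRenyi_of_ae_le_one
      ((ae_mem_of_support_subset hs).mono fun α h => h.2)) hP h
  · obtain ⟨hint, hle, hae⟩ := integrable_of_ratioIntegral_le (x := 0) ha hs (by simpa using hI)
    exact condEntropyNegInfty_mono (quasiconcaveOn_avgRenyi hint hle ha hae) hP h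

/-! ### Exponential growth rates -/

section Rate

open Filter Topology

/-- The eventually positive sequence `x` grows like `exp (c L)` up to subexponential factors. -/
def HasRate (x : ℕ → ℝ) (c : ℝ) : Prop :=
  (∀ᶠ L in atTop, 0 < x L) ∧ Tendsto (fun L : ℕ => Real.log (x L) / L) atTop (𝓝 c)

variable {x y : ℕ → ℝ} {c d : ℝ}

lemma HasRate.mul (hx : HasRate x c) (hy : HasRate y d) : HasRate (fun L => x L * y L) (c + d) := by
  refine ⟨by filter_upwards [hx.1, hy.1] with L h1 h2 using mul_pos h1 h2, ?_⟩
  refine (hx.2.add hy.2).congr' ?_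
  filter_upwards [hx.1, hy.1] with L h1 h2
  rw [Real.log_mul h1.ne' h2.ne', add_div]

lemma HasRate.rpow (hx : HasRate x c) (a : ℝ) : HasRate (fun L => x L ^ a) (a * c) := by
  refine ⟨by filter_upwards [hx.1] with L h1 using Real.rpow_pos_of_pos h1 a, ?_⟩
  refine (hx.2.const_mul a).congr' ?_
  filter_upwards [hx.1] with L h1
  rw [Real.log_rpow h1, mul_div_assoc]

lemma HasRate.div (hx : HasRate x c) (hy : HasRate y d) : HasRate (fun L => x L / y L) (c - d) := by
  refine ⟨by filter_upwards [hx.1, hy.1] with L h1 h2 using div_pos h1 h2, ?_⟩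
  refine (hx.2.sub hy.2).congr' ?_
  filter_upwards [hx.1, hy.1] with L h1 h2
  rw [Real.log_div h1.ne' h2.ne', sub_div]

lemma HasRate.congr (hx : HasRate x c) (h : x =ᶠ[atTop] y) : HasRate y c := by
  refine ⟨by filter_upwards [hx.1, h] with L h1 h2 using h2 ▸ h1, hx.2.congr' ?_⟩
  filter_upwards [h] with L h2
  rw [h2]

lemma hasRate_exp (c : ℝ) : HasRate (fun L => Real.exp (c * L)) c := by
  refine ⟨Eventually.of_forall fun L => Real.exp_pos _, tendsto_const_nhds.congr' ?_⟩
  filter_upwards [eventually_gt_atTop 0] with L hL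
  rw [Real.log_exp, mul_div_cancel_right₀ _ (by exact_mod_cast hL.ne')]

lemma hasRate_of_tendsto (hx : Tendsto x atTop (𝓝 c)) (hc : 0 < c) : HasRate x 0 := by
  refine ⟨hx.eventually_const_lt hc, ?_⟩
  exact ((Real.continuousAt_log hc.ne').tendsto.comp hx).div_atTop tendsto_natCast_atTop_atTop

lemma hasRate_const (hc : 0 < c) : HasRate (fun _ => c) 0 :=
  hasRate_of_tendsto tendsto_const_nhds hc

lemma HasRate.squeeze {z : ℕ → ℝ} (hx : HasRate x c) (hz : HasRate z c)
    (h1 : ∀ᶠ L in atTop, x L ≤ y L) (h2 : ∀ᶠ L in atTop, y L ≤ z L) : HasRate y c := by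
  have hy : ∀ᶠ L in atTop, 0 < y L := by
    filter_upwards [hx.1, h1] with L h3 h4 using h3.trans_le h4
  refine ⟨hy, tendsto_of_tendsto_of_tendsto_of_le_of_le' hx.2 hz.2 ?_ ?_⟩
  · filter_upwards [hx.1, h1] with L h3 h4
    exact div_le_div_of_nonneg_right (Real.log_le_log h3 h4) L.cast_nonneg
  · filter_upwards [hy, h2] with L h3 h4
    exact div_le_div_of_nonneg_right (Real.log_le_log h3 h4) L.cast_nonneg

lemma HasRate.max (hx : HasRate x c) (hy : HasRate y d) :
    HasRate (fun L => x L ⊔ y L) (c ⊔ d) := by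
  refine ⟨by filter_upwards [hx.1] with L h1 using lt_max_of_lt_left h1, ?_⟩
  refine (hx.2.max hy.2).congr' ?_
  filter_upwards [hx.1, hy.1] with L h1 h2
  rcases le_total (x L) (y L) with h | h
  · rw [max_eq_right h, max_eq_right]
    exact div_le_div_of_nonneg_right (Real.log_le_log h1 h) L.cast_nonneg
  · rw [max_eq_left h, max_eq_left]
    exact div_le_div_of_nonneg_right (Real.log_le_log h2 h) L.cast_nonneg

lemma HasRate.add (hx : HasRate x c) (hy : HasRate y d) :
    HasRate (fun L => x L + y L) (c ⊔ d) := by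
  have h2 := (hasRate_const two_pos).mul (hx.max hy)
  rw [zero_add] at h2
  refine (hx.max hy).squeeze h2 ?_ ?_
  · filter_upwards [hx.1, hy.1] with L h1 h2
    exact max_le (by linarith) (by linarith)
  · refine Eventually.of_forall fun L => ?_
    linarith [le_max_left (x L) (y L), le_max_right (x L) (y L)]

lemma HasRate.sum {ι : Type*} {s : Finset ι} (hs : s.Nonempty) {x : ι → ℕ → ℝ} {c : ι → ℝ}
    (h : ∀ j ∈ s, HasRate (x j) (c j)) : HasRate (fun L => ∑ j ∈ s, x j L) (s.sup' hs c) := by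
  induction hs using Finset.Nonempty.cons_induction with
  | singleton a => simpa using h a
  | cons a s ha hs ih =>
    simp only [Finset.sum_cons, Finset.sup'_cons hs]
    exact (h a (Finset.mem_cons_self a s)).add (ih fun j hj => h j (Finset.mem_cons_of_mem hj))

lemma hasRate_ceil_exp {b : ℝ} (hb : 0 ≤ b) :
    HasRate (fun L : ℕ => (⌈Real.exp (b * L)⌉₊ : ℝ)) b := by
  have h2 := (hasRate_const two_pos).mul (hasRate_exp b)
  rw [zero_add] at h2
  refine (hasRate_exp b).squeeze h2 (Eventually.of_forall fun L => Nat.le_ceil _)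
    (Eventually.of_forall fun L => ?_)
  have h1 : 1 ≤ Real.exp (b * L) := Real.one_le_exp (by positivity)
  linarith [(Nat.ceil_lt_add_one (Real.exp_pos (b * L)).le).le]

lemma tendsto_exp_neg_mul {e : ℝ} (he : 0 < e) :
    Tendsto (fun L : ℕ => Real.exp (-e * L)) atTop (𝓝 0) := by
  refine Real.tendsto_exp_atBot.comp ?_
  exact tendsto_natCast_atTop_atTop.const_mul_atTop_of_neg (neg_lt_zero.2 he)

lemma exp_neg_mul_mem_Ioo {e : ℝ} (he : 0 < e) {L : ℕ} (hL : 0 < L) :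
    Real.exp (-e * L) ∈ Ioo (0 : ℝ) 1 := by
  refine ⟨Real.exp_pos _, Real.exp_zero ▸ Real.exp_lt_exp.2 ?_⟩
  have : (0 : ℝ) < L := by exact_mod_cast hL
  nlinarith

end Rate

/-! ### Block distributions -/

section Block

open Filter Topology

/-- The distribution on `Σ j, Fin (n j)` which gives the `j`-th block the mass `w j`, spread
uniformly. Three blocks are enough for all the test families. -/
noncomputable def block (n : Fin 3 → ℕ) (w : Fin 3 → ℝ) : (Σ j, Fin (n j)) → ℝ :=
  fun x => w x.1 / n x.1

variable {n : Fin 3 → ℕ} {w : Fin 3 → ℝ}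

lemma sum_block (f : ℝ → ℝ) :
    ∑ x, f (block n w x) = ∑ j, n j * f (w j / n j) := by
  rw [Fintype.sum_sigma]
  simp [block]

lemma block_mem (hn : ∀ j, 0 < n j) (hw : ∀ j, 0 ≤ w j) (h1 : ∑ j, w j = 1) :
    block n w ∈ stdSimplex ℝ (Σ j, Fin (n j)) := by
  refine ⟨fun x => div_nonneg (hw _) (Nat.cast_nonneg _), ?_⟩
  refine (sum_block id).trans ?_
  rw [← h1]
  refine Finset.sum_congr rfl fun j _ => ?_
  exact mul_div_cancel₀ _ (by exact_mod_cast (hn j).ne')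

lemma mix_block (m : ℝ) (w w' : Fin 3 → ℝ) :
    mix m (block n w) (block n w') = block n (fun j => m * w j + (1 - m) * w' j) := by
  ext x
  simp only [mix_apply, block]
  ring

lemma powSum_block (hn : ∀ j, 0 < n j) {J : Finset (Fin 3)} (h0 : ∀ j ∉ J, w j = 0)
    (hJ : ∀ j ∈ J, 0 < w j) (a : ℝ) :
    powSum a (block n w) = ∑ j ∈ J, n j * (w j / n j) ^ a := by
  classical
  have := sum_block (n := n) (w := w) fun p => if p ≠ 0 then p ^ a else 0
  unfold powSum
  rw [Finset.sum_filter, this, ← Finset.sum_subset (Finset.subset_univ J)]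
  · refine Finset.sum_congr rfl fun j hj => ?_
    have : w j / n j ≠ 0 := div_ne_zero (hJ j hj).ne' (by exact_mod_cast (hn j).ne')
    rw [if_pos this]
  · intro j _ hj
    simp [h0 j hj]

/-- Block sizes growing like `exp (b j * L)`. -/
noncomputable def size (b : Fin 3 → ℝ) (L : ℕ) (j : Fin 3) : ℕ := ⌈Real.exp (b j * L)⌉₊

lemma size_pos (b : Fin 3 → ℝ) (L : ℕ) (j : Fin 3) : 0 < size b L j :=
  Nat.ceil_pos.2 (Real.exp_pos _)

/-- A sequence of weights of blocks: the blocks in `J` have masses decaying like `exp (-e j * L)`,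
the others have mass zero, and the mass concentrates on the block `j₀`. -/
structure IsBlockWeight (e : Fin 3 → ℝ) (J : Finset (Fin 3)) (j₀ : Fin 3)
    (w : ℕ → Fin 3 → ℝ) : Prop where
  sum_eq : ∀ L, ∑ j, w L j = 1
  eq_zero : ∀ L, ∀ j ∉ J, w L j = 0
  rate : ∀ j ∈ J, HasRate (fun L => w L j) (-e j)
  mem : j₀ ∈ J
  exponent_eq_zero : e j₀ = 0
  tendsto : ∀ j ∈ J, Tendsto (fun L => w L j) atTop (𝓝 (if j = j₀ then 1 else 0))

/-- The limit of `H_α / L` along a sequence of block distributions with sizes `exp (b j * L)` and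
masses `exp (-e j * L)`. -/
noncomputable def limitEntropy (b e : Fin 3 → ℝ) (J : Finset (Fin 3)) (j₀ : Fin 3) (hJ : J.Nonempty)
    (α : ℝ≥0∞) : ℝ :=
  open Classical in
  if α < 1 then J.sup' hJ fun j => b j - ratio α * e j
  else if α = 1 then b j₀
  else J.inf' hJ fun j => b j - ratio α * e j

variable {b e : Fin 3 → ℝ} {J : Finset (Fin 3)} {j₀ : Fin 3} {w : ℕ → Fin 3 → ℝ}

lemma IsBlockWeight.nonempty (hw : IsBlockWeight e J j₀ w) : J.Nonempty := ⟨j₀, hw.mem⟩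

lemma IsBlockWeight.eventually_pos (hw : IsBlockWeight e J j₀ w) :
    ∀ᶠ L in atTop, ∀ j ∈ J, 0 < w L j :=
  (Finset.eventually_all J).2 fun j hj => (hw.rate j hj).1

lemma IsBlockWeight.eventually_mem (hw : IsBlockWeight e J j₀ w) (b : Fin 3 → ℝ) :
    ∀ᶠ L in atTop, block (size b L) (w L) ∈ stdSimplex ℝ (Σ j, Fin (size b L j)) := by
  filter_upwards [hw.eventually_pos] with L hL
  refine block_mem (size_pos b L) (fun j => ?_) (hw.sum_eq L)
  by_cases hj : j ∈ J
  · exact (hL j hj).le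
  · exact (hw.eq_zero L j hj).ge

lemma IsBlockWeight.hasRate_powSum (hw : IsBlockWeight e J j₀ w) (hb : ∀ j, 0 ≤ b j) (a : ℝ) :
    HasRate (fun L => powSum a (block (size b L) (w L)))
      (J.sup' hw.nonempty fun j => b j + a * (-e j - b j)) := by
  refine (HasRate.sum hw.nonempty (x := fun j L => size b L j * (w L j / size b L j) ^ a)
    fun j hj => (hasRate_ceil_exp (hb j)).mul
      (((hw.rate j hj).div (hasRate_ceil_exp (hb j))).rpow a)).congr ?_
  filter_upwards [hw.eventually_pos] with L hL
  exact (powSum_block (size_pos b L) (hw.eq_zero L) hL a).symm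

lemma IsBlockWeight.hasRate_iSup (hw : IsBlockWeight e J j₀ w) (hb : ∀ j, 0 ≤ b j) :
    HasRate (fun L => ⨆ x, block (size b L) (w L) x)
      (J.sup' hw.nonempty fun j => -e j - b j) := by
  have hs := HasRate.sum hw.nonempty (x := fun j L => w L j / size b L j)
    fun j hj => (hw.rate j hj).div (hasRate_ceil_exp (hb j))
  -- The supremum lies between the sum over the three blocks and a third of it.
  have hs3 := (hasRate_const (c := 1 / 3) (by norm_num)).mul hs
  rw [zero_add] at hs3
  refine hs3.squeeze hs ?_ ?_
  · filter_upwards [hw.eventually_pos] with L hL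
    have h : ∀ j ∈ J, w L j / size b L j ≤ ⨆ x, block (size b L) (w L) x := fun j _ =>
      le_ciSup (f := block (size b L) (w L)) (Finite.bddAbove_range _) ⟨j, 0, size_pos b L j⟩
    have h1 := Finset.sum_le_card_nsmul _ _ _ h
    rw [nsmul_eq_mul] at h1
    have h2 : (J.card : ℝ) ≤ 3 := by exact_mod_cast J.card_le_univ
    have h3 : 0 ≤ ⨆ x, block (size b L) (w L) x :=
      le_trans (div_nonneg (hL j₀ hw.mem).le (Nat.cast_nonneg _)) (h j₀ hw.mem)
    nlinarith
  · filter_upwards [hw.eventually_pos] with L hL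
    have : Nonempty (Σ j, Fin (size b L j)) := ⟨⟨j₀, 0, size_pos b L j₀⟩⟩
    have hnn : ∀ j ∈ J, 0 ≤ w L j / size b L j := fun j hj =>
      div_nonneg (hL j hj).le (Nat.cast_nonneg _)
    refine ciSup_le fun x => ?_
    by_cases hx : x.1 ∈ J
    · exact Finset.single_le_sum (f := fun j => w L j / (size b L j : ℝ)) hnn hx
    · rw [block, hw.eq_zero L _ hx, zero_div]
      exact Finset.sum_nonneg hnn

lemma mul_sup'_of_nonpos {c : ℝ} (hc : c ≤ 0) (h : J.Nonempty) (f : Fin 3 → ℝ) :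
    c * J.sup' h f = J.inf' h fun j => c * f j :=
  le_antisymm
    (Finset.le_inf' _ _ fun _ hj => mul_le_mul_of_nonpos_left (Finset.le_sup' f hj) hc) (by
      obtain ⟨j, hj, h⟩ := J.exists_mem_eq_sup' h f
      exact h ▸ Finset.inf'_le (fun j => c * f j) hj)

lemma mul_sup'_of_nonneg {c : ℝ} (hc : 0 ≤ c) (h : J.Nonempty) (f : Fin 3 → ℝ) :
    c * J.sup' h f = J.sup' h fun j => c * f j :=
  le_antisymm (by
      obtain ⟨j, hj, h⟩ := J.exists_mem_eq_sup' h f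
      exact h ▸ Finset.le_sup' (fun j => c * f j) hj)
    (Finset.sup'_le _ _ fun _ hj => mul_le_mul_of_nonneg_left (Finset.le_sup' f hj) hc)

lemma IsBlockWeight.tendsto_renyi (hw : IsBlockWeight e J j₀ w) (hb : ∀ j, 0 ≤ b j) (α : ℝ≥0∞) :
    Tendsto (fun L : ℕ => renyi α (block (size b L) (w L)) / L) atTop
      (𝓝 (limitEntropy b e J j₀ hw.nonempty α)) := by
  unfold limitEntropy
  by_cases ht : α = ⊤
  · subst ht
    rw [if_neg (by simp), if_neg (by simp)]
    have h := (hw.hasRate_iSup hb).2.const_mul (-1)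
    rw [mul_sup'_of_nonpos (by norm_num)] at h
    simp only [renyi_top, ratio_top]
    convert h using 2
    · ring
    · congr 1; ext j; ring
  by_cases h1 : α = 1
  · subst h1
    rw [if_neg (by simp), if_pos rfl]
    have h : ∀ j ∈ J, Tendsto (fun L : ℕ => w L j *
        (Real.log (size b L j) / L - Real.log (w L j) / L)) atTop
        (𝓝 ((if j = j₀ then 1 else 0) * (b j - -e j))) := fun j hj =>
      (hw.tendsto j hj).mul ((hasRate_ceil_exp (hb j)).2.sub (hw.rate j hj).2)
    have h' := tendsto_finsetSum J h
    simp only [ite_mul, one_mul, zero_mul] at h'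
    rw [Finset.sum_ite_eq' J j₀, if_pos hw.mem, hw.exponent_eq_zero, neg_zero, sub_zero] at h'
    refine h'.congr' ?_
    filter_upwards [hw.eventually_pos] with L hL
    rw [renyi_one, sum_block, ← Finset.sum_subset (Finset.subset_univ J), Finset.sum_div]
    · refine Finset.sum_congr rfl fun j hj => ?_
      have hs : (size b L j : ℝ) ≠ 0 := by exact_mod_cast (size_pos b L j).ne'
      rw [Real.negMulLog, Real.log_div (hL j hj).ne' hs]
      field_simp
      ring
    · intro j _ hj
      simp [hw.eq_zero L j hj]
  have h := (hw.hasRate_powSum hb α.toReal).2.const_mul (1 / (1 - α.toReal))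
  have hne : 1 - α.toReal ≠ 0 := by
    rcases lt_or_gt_of_ne h1 with h | h
    · linarith [toReal_lt_one h]
    · linarith [one_lt_toReal h ht]
  have e1 : (fun j => b j - ratio α * e j) =
      fun j => 1 / (1 - α.toReal) * (b j + α.toReal * (-e j - b j)) := by
    ext j
    rw [ratio_eq ht]
    field_simp
    ring
  rw [e1]
  simp only [renyi_eq ht h1, mul_div_assoc]
  rcases lt_or_gt_of_ne h1 with hα | hα
  · rw [if_pos hα, ← mul_sup'_of_nonneg]
    · exact h
    · exact one_div_nonneg.2 (by linarith [toReal_lt_one hα])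
  · rw [if_neg hα.not_gt, if_neg h1, ← mul_sup'_of_nonpos]
    · exact h
    · exact one_div_nonpos.2 (by linarith [one_lt_toReal hα ht])

lemma exists_log_card_le (hb : ∀ j, 0 ≤ b j) :
    ∃ C : ℝ, ∀ L : ℕ, Real.log (Fintype.card (Σ j, Fin (size b L j))) / L ≤ C := by
  have h := (HasRate.sum Finset.univ_nonempty (x := fun j L => (size b L j : ℝ))
    fun j _ => hasRate_ceil_exp (hb j)).2
  obtain ⟨C, hC⟩ := h.bddAbove_range
  refine ⟨C, fun L => ?_⟩
  have := hC ⟨L, rfl⟩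
  simpa using this

lemma integrable_limitEntropy_and_tendsto (hw : IsBlockWeight e J j₀ w) (hb : ∀ j, 0 ≤ b j)
    (τ : ProbabilityMeasure ℝ≥0∞) :
    Integrable (limitEntropy b e J j₀ hw.nonempty) (τ : Measure ℝ≥0∞) ∧
    Tendsto (fun L : ℕ => avgRenyi τ (block (size b L) (w L)) / L) atTop
      (𝓝 (∫ α, limitEntropy b e J j₀ hw.nonempty α ∂(τ : Measure ℝ≥0∞))) := by
  obtain ⟨C, hC⟩ := exists_log_card_le hb
  have hbd : ∀ᶠ L : ℕ in atTop, ∀ α, ‖renyi α (block (size b L) (w L)) / L‖ ≤ C := by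
    filter_upwards [hw.eventually_mem b] with L hL α
    rw [Real.norm_of_nonneg (div_nonneg (renyi_nonneg hL α) L.cast_nonneg)]
    exact (div_le_div_of_nonneg_right (renyi_le_log_card hL α) L.cast_nonneg).trans (hC L)
  have hmeas : ∀ L : ℕ, Measurable fun α => renyi α (block (size b L) (w L)) / (L : ℝ) :=
    fun L => (measurable_renyi _).div_const _
  constructor
  · refine Integrable.of_bound (measurable_of_tendsto_metrizable hmeas
      (tendsto_pi_nhds.2 fun α => hw.tendsto_renyi hb α)).aestronglyMeasurable C
      (ae_of_all _ fun α => ?_)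
    exact le_of_tendsto (hw.tendsto_renyi hb α).norm (hbd.mono fun L hL => hL α)
  · simp only [avgRenyi, ← integral_div]
    exact tendsto_integral_filter_of_dominated_convergence (fun _ => C)
      (Eventually.of_forall fun L => (hmeas L).aestronglyMeasurable)
      (hbd.mono fun L hL => ae_of_all _ hL) (integrable_const C)
      (ae_of_all _ fun α => hw.tendsto_renyi hb α)

end Block

/-! ### Monotonicity forces inequalities for mixtures -/

section Merge

variable {X : Type} [Fintype X] {p q : X → ℝ} {m t : ℝ} {τ : ProbabilityMeasure ℝ≥0∞}

/-- Forgetting a binary side information, which is `true` with probability `m`, is a conditionally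
mixing channel. -/
lemma condEntropy_le_of_mem_Dbulk (h : (t, τ) ∈ Dbulk) (hp : p ∈ stdSimplex ℝ X)
    (hq : q ∈ stdSimplex ℝ X) (hm : m ∈ Ioo (0 : ℝ) 1) :
    1 / t * Real.log (m * Real.exp (t * avgRenyi τ p) + (1 - m) * Real.exp (t * avgRenyi τ q)) ≤
      avgRenyi τ (mix m p q) := by
  classical
  have hm0 := hm.1
  have hm1 : 0 < 1 - m := by linarith [hm.2]
  let P : Matrix X Bool ℝ := Matrix.of fun x b => bif b then m * p x else (1 - m) * q x
  let Q : Matrix X Unit ℝ := Matrix.of fun x _ => mix m p q x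
  have hPt : marginal P true = m := by
    simp [marginal, P, ← Finset.mul_sum, hp.2]
  have hPf : marginal P false = 1 - m := by
    simp [marginal, P, ← Finset.mul_sum, hq.2]
  have hQ1 : marginal Q () = 1 := (mix_mem hp hq hm).2
  have hct : conditional P true = p := by
    ext x
    simp [conditional, hPt, P, hm0.ne']
  have hcf : conditional P false = q := by
    ext x
    simp [conditional, hPf, P, hm1.ne']
  have hcQ : conditional Q () = mix m p q := by
    ext x
    simp [conditional, hQ1, Q]
  have hP : IsProb P := by
    refine ⟨fun x b => ?_, ?_⟩
    · cases b
      · exact mul_nonneg hm1.le (hq.1 x)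
      · exact mul_nonneg hm0.le (hp.1 x)
    · rw [← sum_marginal_eq, Fintype.sum_bool, hPt, hPf]
      ring
  have hPQ : CondMixes P Q := by
    refine ⟨1, fun _ => 1, fun _ => Matrix.of fun _ _ => 1, fun _ => one_mem _,
      fun _ => ⟨by simp, by simp⟩, ⟨by simp, by simp⟩, ?_⟩
    ext x y
    simp [P, Q, Matrix.mul_apply, mix_apply]
  have := h.2 X Bool Unit P Q hP hPQ
  simp only [condEntropy, Fintype.sum_bool, hPt, hPf, hct, hcf, Finset.univ_unique,
    Finset.sum_singleton, PUnit.default_eq_unit, hQ1, hcQ, one_mul, Real.log_exp] at this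
  rwa [← mul_assoc, one_div_mul_cancel h.1, one_mul] at this

lemma log_add_le_of_mem_Dbulk (ht : 0 < t) (h : (t, τ) ∈ Dbulk) (hp : p ∈ stdSimplex ℝ X)
    (hq : q ∈ stdSimplex ℝ X) (hm : m ∈ Ioo (0 : ℝ) 1) :
    Real.log m + t * avgRenyi τ p ≤ t * avgRenyi τ (mix m p q) := by
  have h1 := condEntropy_le_of_mem_Dbulk h hp hq hm
  rw [one_div_mul_eq_div, div_le_iff₀ ht, mul_comm _ t] at h1
  refine le_trans ?_ h1
  rw [← Real.log_exp (t * avgRenyi τ p), ← Real.log_mul hm.1.ne' (Real.exp_pos _).ne',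
    Real.log_exp]
  refine Real.log_le_log (mul_pos hm.1 (Real.exp_pos _)) (le_add_of_nonneg_right ?_)
  exact mul_nonneg (by linarith [hm.2]) (Real.exp_pos _).le

lemma le_max_of_mem_Dbulk (ht : t < 0) (h : (t, τ) ∈ Dbulk) (hp : p ∈ stdSimplex ℝ X)
    (hq : q ∈ stdSimplex ℝ X) (hm : m ∈ Ioo (0 : ℝ) 1) :
    t * avgRenyi τ (mix m p q) ≤ Real.log 2 +
      max (Real.log m + t * avgRenyi τ p) (Real.log (1 - m) + t * avgRenyi τ q) := by
  have hm1 : 0 < 1 - m := by linarith [hm.2]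
  have h1 := condEntropy_le_of_mem_Dbulk h hp hq hm
  rw [one_div_mul_eq_div, div_le_iff_of_neg ht, mul_comm _ t] at h1
  refine h1.trans ?_
  have hA := mul_pos hm.1 (Real.exp_pos (t * avgRenyi τ p))
  have hB := mul_pos hm1 (Real.exp_pos (t * avgRenyi τ q))
  have eA := Real.log_mul hm.1.ne' (Real.exp_pos (t * avgRenyi τ p)).ne'
  have eB := Real.log_mul hm1.ne' (Real.exp_pos (t * avgRenyi τ q)).ne'
  rw [Real.log_exp] at eA eB
  rw [← eA, ← eB]
  rcases le_total (m * Real.exp (t * avgRenyi τ p)) ((1 - m) * Real.exp (t * avgRenyi τ q))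
    with hle | hle
  · rw [max_eq_right (Real.log_le_log hA hle), ← Real.log_mul two_ne_zero hB.ne']
    exact Real.log_le_log (by positivity) (by linarith)
  · rw [max_eq_left (Real.log_le_log hB hle), ← Real.log_mul two_ne_zero hA.ne']
    exact Real.log_le_log (by positivity) (by linarith)

end Merge

section Asymptotic

open Filter Topology

variable {t : ℝ} {τ : ProbabilityMeasure ℝ≥0∞} {b e e₁ e₂ : Fin 3 → ℝ} {J J₁ J₂ : Finset (Fin 3)}
  {j₀ j₁ j₂ : Fin 3} {w w₁ w₂ : ℕ → Fin 3 → ℝ} {m : ℕ → ℝ} {c c₁ c₂ : ℝ}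

/-- The exponential-scale form of `log_add_le_of_mem_Dbulk` for block distributions. -/
lemma limit_le_of_mem_Dbulk (ht : 0 < t) (h : (t, τ) ∈ Dbulk) (hb : ∀ j, 0 ≤ b j)
    (h₁ : IsBlockWeight e₁ J₁ j₁ w₁) (h₂ : IsBlockWeight e₂ J₂ j₂ w₂)
    (hw : IsBlockWeight e J j₀ w) (hm : HasRate m c) (hm' : ∀ᶠ L in atTop, m L ∈ Ioo (0 : ℝ) 1)
    (hmix : ∀ L j, w L j = m L * w₁ L j + (1 - m L) * w₂ L j) :
    c + t * ∫ α, limitEntropy b e₁ J₁ j₁ h₁.nonempty α ∂(τ : Measure ℝ≥0∞) ≤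
      t * ∫ α, limitEntropy b e J j₀ hw.nonempty α ∂(τ : Measure ℝ≥0∞) := by
  refine le_of_tendsto_of_tendsto
    (hm.2.add ((integrable_limitEntropy_and_tendsto h₁ hb τ).2.const_mul t))
    ((integrable_limitEntropy_and_tendsto hw hb τ).2.const_mul t) ?_
  filter_upwards [h₁.eventually_mem b, h₂.eventually_mem b, hm'] with L hp hq hL
  have := log_add_le_of_mem_Dbulk ht h hp hq hL
  rw [mix_block, ← funext (hmix L)] at this
  have := div_le_div_of_nonneg_right this (L.cast_nonneg (α := ℝ))
  rwa [add_div, mul_div_assoc, mul_div_assoc] at this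

/-- The exponential-scale form of `le_max_of_mem_Dbulk` for block distributions; the term `log 2`
disappears in the limit. -/
lemma limit_le_max_of_mem_Dbulk (ht : t < 0) (h : (t, τ) ∈ Dbulk) (hb : ∀ j, 0 ≤ b j)
    (h₁ : IsBlockWeight e₁ J₁ j₁ w₁) (h₂ : IsBlockWeight e₂ J₂ j₂ w₂)
    (hw : IsBlockWeight e J j₀ w) (hm₁ : HasRate m c₁) (hm₂ : HasRate (fun L => 1 - m L) c₂)
    (hmix : ∀ L j, w L j = m L * w₁ L j + (1 - m L) * w₂ L j) :
    t * ∫ α, limitEntropy b e J j₀ hw.nonempty α ∂(τ : Measure ℝ≥0∞) ≤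
      max (c₁ + t * ∫ α, limitEntropy b e₁ J₁ j₁ h₁.nonempty α ∂(τ : Measure ℝ≥0∞))
        (c₂ + t * ∫ α, limitEntropy b e₂ J₂ j₂ h₂.nonempty α ∂(τ : Measure ℝ≥0∞)) := by
  have h1 := hm₁.2.add ((integrable_limitEntropy_and_tendsto h₁ hb τ).2.const_mul t)
  have h2 := hm₂.2.add ((integrable_limitEntropy_and_tendsto h₂ hb τ).2.const_mul t)
  have h3 := (hasRate_const two_pos).2.add (h1.max h2)
  rw [zero_add] at h3
  refine le_of_tendsto_of_tendsto
    ((integrable_limitEntropy_and_tendsto hw hb τ).2.const_mul t) h3 ?_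
  filter_upwards [h₁.eventually_mem b, h₂.eventually_mem b, hm₁.1, hm₂.1] with L hp hq hL1 hL2
  have := le_max_of_mem_Dbulk ht h hp hq ⟨hL1, by linarith⟩
  rw [mix_block, ← funext (hmix L)] at this
  have := div_le_div_of_nonneg_right this (L.cast_nonneg (α := ℝ))
  rwa [add_div, ← max_div_div_right L.cast_nonneg, add_div, add_div, mul_div_assoc,
    mul_div_assoc, mul_div_assoc] at this

end Asymptotic

/-! ### Test families of block distributions -/

section Families

open Filter Topology

lemma hasRate_one_sub_exp {e : ℝ} (he : 0 < e) :
    HasRate (fun L : ℕ => 1 - Real.exp (-e * L)) 0 :=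
  hasRate_of_tendsto (c := 1) (by simpa using (tendsto_exp_neg_mul he).const_sub 1) one_pos

lemma isBlockWeight_single (j : Fin 3) :
    IsBlockWeight 0 {j} j fun _ => Pi.single j 1 where
  sum_eq L := by simp
  eq_zero L i hi := by
    rw [Finset.mem_singleton] at hi
    simp [hi]
  rate i hi := by
    rw [Finset.mem_singleton] at hi
    subst hi
    simpa using hasRate_const one_pos
  mem := Finset.mem_singleton_self j
  exponent_eq_zero := rfl
  tendsto i hi := by
    rw [Finset.mem_singleton] at hi
    subst hi
    simp

/-- Two blocks, the main one `i` and one `j` of mass `exp (-e * L)`. -/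
lemma isBlockWeight_pair {i j : Fin 3} (hij : i ≠ j) {e : ℝ} (he : 0 < e) :
    IsBlockWeight (Pi.single j e) {i, j} i fun L =>
      Pi.single i (1 - Real.exp (-e * L)) + Pi.single j (Real.exp (-e * L)) where
  sum_eq L := by simp [Finset.sum_add_distrib]
  eq_zero L k hk := by
    simp only [Finset.mem_insert, Finset.mem_singleton, not_or] at hk
    simp [hk.1, hk.2]
  rate k hk := by
    rw [Finset.mem_insert, Finset.mem_singleton] at hk
    rcases hk with rfl | rfl
    · simpa [hij] using hasRate_one_sub_exp he
    · simpa [hij.symm] using hasRate_exp (-e)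
  mem := by simp
  exponent_eq_zero := by simp [hij]
  tendsto k hk := by
    rw [Finset.mem_insert, Finset.mem_singleton] at hk
    rcases hk with rfl | rfl
    · simpa [hij] using (tendsto_exp_neg_mul he).const_sub 1
    · simpa [hij.symm] using tendsto_exp_neg_mul he

end Families

/-! ### Bounds for limit entropies and their integrals -/

section Bounds

variable {b e : Fin 3 → ℝ} {J : Finset (Fin 3)} {j₀ : Fin 3} {hJ : J.Nonempty} {α : ℝ≥0∞} {v : ℝ}

lemma limitEntropy_le_of_lt_one (hα : α < 1) (h : ∀ j ∈ J, b j - ratio α * e j ≤ v) :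
    limitEntropy b e J j₀ hJ α ≤ v := by
  rw [limitEntropy, if_pos hα]
  exact Finset.sup'_le _ _ h

lemma le_limitEntropy_of_lt_one (hα : α < 1) {j : Fin 3} (hj : j ∈ J) :
    b j - ratio α * e j ≤ limitEntropy b e J j₀ hJ α := by
  rw [limitEntropy, if_pos hα]
  exact Finset.le_sup' (fun j => b j - ratio α * e j) hj

lemma limitEntropy_one : limitEntropy b e J j₀ hJ 1 = b j₀ := by simp [limitEntropy]

lemma limitEntropy_le_of_one_lt (hα : 1 < α) {j : Fin 3} (hj : j ∈ J) :
    limitEntropy b e J j₀ hJ α ≤ b j - ratio α * e j := by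
  rw [limitEntropy, if_neg hα.not_gt, if_neg hα.ne']
  exact Finset.inf'_le (fun j => b j - ratio α * e j) hj

lemma le_limitEntropy_of_one_lt (hα : 1 < α) (h : ∀ j ∈ J, v ≤ b j - ratio α * e j) :
    v ≤ limitEntropy b e J j₀ hJ α := by
  rw [limitEntropy, if_neg hα.not_gt, if_neg hα.ne']
  exact Finset.le_inf' _ _ h

end Bounds

section Split

open Filter Topology

variable {τ : ProbabilityMeasure ℝ≥0∞} {f g h : ℝ≥0∞ → ℝ} {c : ℝ}

lemma integral_split (hf : Integrable f (τ : Measure ℝ≥0∞)) :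
    ∫ α, f α ∂(τ : Measure ℝ≥0∞) = ∫ α in Iio 1, f α ∂(τ : Measure ℝ≥0∞) +
      (τ : Measure ℝ≥0∞).real {1} * f 1 + ∫ α in Ioi 1, f α ∂(τ : Measure ℝ≥0∞) := by
  have h1 : (Iic 1 : Set ℝ≥0∞) = Iio 1 ∪ {1} := by ext; simp [le_iff_lt_or_eq]
  rw [← integral_add_compl measurableSet_Iic hf (s := Iic 1), compl_Iic, h1,
    setIntegral_union (by simp) (measurableSet_singleton _) hf.integrableOn hf.integrableOn,
    integral_singleton, smul_eq_mul]

lemma measureReal_split :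
    (τ : Measure ℝ≥0∞).real (Iio 1) + (τ : Measure ℝ≥0∞).real {1} +
      (τ : Measure ℝ≥0∞).real (Ioi 1) = 1 := by
  have := integral_split (integrable_const (μ := (τ : Measure ℝ≥0∞)) (1 : ℝ))
  simpa using this.symm

lemma integral_le_split (hf : Integrable f (τ : Measure ℝ≥0∞))
    (hg : Integrable g (τ : Measure ℝ≥0∞)) (hh : Integrable h (τ : Measure ℝ≥0∞))
    (h0 : ∀ α < 1, f α ≤ g α) (h1 : f 1 ≤ c) (h2 : ∀ α > 1, f α ≤ h α) :
    ∫ α, f α ∂(τ : Measure ℝ≥0∞) ≤ ∫ α in Iio 1, g α ∂(τ : Measure ℝ≥0∞) +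
      (τ : Measure ℝ≥0∞).real {1} * c + ∫ α in Ioi 1, h α ∂(τ : Measure ℝ≥0∞) := by
  rw [integral_split hf]
  have e0 := setIntegral_mono_on hf.integrableOn hg.integrableOn measurableSet_Iio h0
  have e2 := setIntegral_mono_on hf.integrableOn hh.integrableOn measurableSet_Ioi h2
  have e1 := mul_le_mul_of_nonneg_left h1 (measureReal_nonneg (μ := (τ : Measure ℝ≥0∞)) (s := {1}))
  linarith

lemma split_le_integral (hf : Integrable f (τ : Measure ℝ≥0∞))
    (hg : Integrable g (τ : Measure ℝ≥0∞)) (hh : Integrable h (τ : Measure ℝ≥0∞))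
    (h0 : ∀ α < 1, g α ≤ f α) (h1 : c ≤ f 1) (h2 : ∀ α > 1, h α ≤ f α) :
    ∫ α in Iio 1, g α ∂(τ : Measure ℝ≥0∞) + (τ : Measure ℝ≥0∞).real {1} * c +
      ∫ α in Ioi 1, h α ∂(τ : Measure ℝ≥0∞) ≤ ∫ α, f α ∂(τ : Measure ℝ≥0∞) := by
  rw [integral_split hf]
  have e0 := setIntegral_mono_on hg.integrableOn hf.integrableOn measurableSet_Iio h0
  have e2 := setIntegral_mono_on hh.integrableOn hf.integrableOn measurableSet_Ioi h2
  have e1 := mul_le_mul_of_nonneg_left h1 (measureReal_nonneg (μ := (τ : Measure ℝ≥0∞)) (s := {1}))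
  linarith

lemma integrable_min_ratio (hint : Integrable ratio (τ : Measure ℝ≥0∞)) (k : ℝ) :
    Integrable (fun α => min (ratio α) k) (τ : Measure ℝ≥0∞) :=
  hint.inf (integrable_const k)

lemma tendsto_setIntegral_min_ratio (hint : Integrable ratio (τ : Measure ℝ≥0∞)) :
    Tendsto (fun k : ℕ => ∫ α in Iio 1, min (ratio α) k ∂(τ : Measure ℝ≥0∞)) atTop
      (𝓝 (∫ α in Iio 1, ratio α ∂(τ : Measure ℝ≥0∞))) := by
  refine tendsto_integral_of_dominated_convergence (fun α => |ratio α|)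
    (fun k => (integrable_min_ratio hint k).integrableOn.aestronglyMeasurable)
    hint.abs.integrableOn (fun k => ?_) (ae_of_all _ fun α => ?_)
  · refine ae_restrict_of_forall_mem measurableSet_Iio fun α hα => ?_
    have := ratio_nonneg hα
    rw [Real.norm_of_nonneg (le_min this k.cast_nonneg), abs_of_nonneg this]
    exact min_le_left _ _
  · refine tendsto_const_nhds.congr' ?_
    filter_upwards [eventually_ge_atTop ⌈ratio α⌉₊] with k hk
    exact (min_eq_left ((Nat.le_ceil _).trans (by exact_mod_cast hk))).symm

lemma setIntegral_min_ratio_nonneg {k : ℝ} (hk : 0 ≤ k) :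
    0 ≤ ∫ α in Iio 1, min (ratio α) k ∂(τ : Measure ℝ≥0∞) :=
  setIntegral_nonneg measurableSet_Iio fun _ hα => le_min (ratio_nonneg hα) hk

end Split

/-! ### Necessity for positive `t` -/

section Positive

open Filter Topology

variable {t : ℝ} {τ : ProbabilityMeasure ℝ≥0∞}

/-- The inequality obtained by mixing a uniform distribution on about `exp L` points, with the small
weight `exp (-L / k)`, into a point mass. -/
lemma mass_bound_of_pos (ht : 0 < t) (hint : Integrable ratio (τ : Measure ℝ≥0∞))
    (h : (t, τ) ∈ Dbulk) {k : ℝ} (hk : 0 < k) :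
    1 + (∫ α in Iio 1, min (ratio α) k ∂(τ : Measure ℝ≥0∞)) / k ≤
      (τ : Measure ℝ≥0∞).real (Iio 1) + 1 / t / k := by
  have hk' : 0 < 1 / k := by positivity
  have hb : ∀ j, 0 ≤ (![1, 0, 0] : Fin 3 → ℝ) j := by
    intro j; fin_cases j <;> simp
  have h₁ := isBlockWeight_single 0
  have h₂ := isBlockWeight_single 1
  have hw := isBlockWeight_pair (i := 1) (j := 0) (by decide) hk'
  have key := limit_le_of_mem_Dbulk ht h hb h₁ h₂ hw (hasRate_exp (-(1 / k)))
    (by filter_upwards [eventually_gt_atTop 0] with L hL using exp_neg_mul_mem_Ioo hk' hL)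
    (fun L j => by fin_cases j <;> simp)
  have e1 : ∀ α, limitEntropy ![1, 0, 0] 0 {0} 0 h₁.nonempty α = 1 := fun α => by
    simp [limitEntropy]
  simp only [e1, integral_const, probReal_univ, smul_eq_mul, mul_one] at key
  have hle := integral_le_split (c := 0) (g := fun α => 1 - 1 / k * min (ratio α) k)
    (h := fun _ => 0) (integrable_limitEntropy_and_tendsto hw hb τ).1
    ((integrable_const 1).sub ((integrable_min_ratio hint k).const_mul _)) (integrable_const 0)
    (fun α hα => limitEntropy_le_of_lt_one hα fun j hj => by
      have hm : 1 / k * min (ratio α) k ≤ 1 / k * ratio α :=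
        mul_le_mul_of_nonneg_left (min_le_left _ _) hk'.le
      have hm' : 1 / k * min (ratio α) k ≤ 1 / k * k :=
        mul_le_mul_of_nonneg_left (min_le_right _ _) hk'.le
      rw [one_div_mul_cancel hk.ne'] at hm'
      fin_cases hj
      · simpa using hm'
      · simp only [Fin.isValue, Matrix.cons_val_zero, Pi.single_eq_same]
        linarith)
    (by rw [limitEntropy_one]; simp)
    (fun α hα => (limitEntropy_le_of_one_lt hα (j := 1) (by simp)).trans (by simp))
  rw [integral_sub (integrable_const _) ((integrable_min_ratio hint k).const_mul _).integrableOn,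
    integral_const_mul] at hle
  simp only [integral_const, measureReal_restrict_apply_univ, smul_eq_mul, mul_one, mul_zero,
    add_zero] at hle
  have h3 := key.trans (mul_le_mul_of_nonneg_left hle ht.le)
  have h4 : 1 - 1 / k / t ≤ (τ : Measure ℝ≥0∞).real (Iio 1) -
      1 / k * ∫ α in Iio 1, min (ratio α) k ∂(τ : Measure ℝ≥0∞) := by
    refine le_of_mul_le_mul_left ?_ ht
    have : t * (1 - 1 / k / t) = -(1 / k) + t := by field_simp; ring
    rw [this]
    exact h3
  have h5 : 1 / k / t = 1 / t / k := by field_simp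
  rw [h5, one_div_mul_eq_div] at h4
  linarith

lemma mem_DbulkTilde_of_pos (ht : 0 < t) (hint : Integrable ratio (τ : Measure ℝ≥0∞))
    (h : (t, τ) ∈ Dbulk) : (t, τ) ∈ DbulkTilde := by
  have hk : ∀ k : ℕ, 0 < k → 1 + (∫ α in Iio 1, min (ratio α) k ∂(τ : Measure ℝ≥0∞)) / k ≤
      (τ : Measure ℝ≥0∞).real (Iio 1) + 1 / t / k := fun k hk =>
    mass_bound_of_pos ht hint h (by exact_mod_cast hk)
  have h1 : (τ : Measure ℝ≥0∞).real (Iio 1) = 1 := by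
    refine le_antisymm measureReal_le_one ?_
    have hlim : Tendsto (fun k : ℕ => (τ : Measure ℝ≥0∞).real (Iio 1) + 1 / t / k) atTop
        (𝓝 ((τ : Measure ℝ≥0∞).real (Iio 1) + 0)) :=
      tendsto_const_nhds.add (tendsto_const_div_atTop_nhds_zero_nat _)
    rw [add_zero] at hlim
    refine ge_of_tendsto hlim ?_
    filter_upwards [eventually_gt_atTop 0] with k hk0
    refine le_trans (le_add_of_nonneg_right ?_) (hk k hk0)
    exact div_nonneg (setIntegral_min_ratio_nonneg k.cast_nonneg) k.cast_nonneg
  have hI : ∫ α in Iio 1, ratio α ∂(τ : Measure ℝ≥0∞) ≤ 1 / t := by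
    refine le_of_tendsto (tendsto_setIntegral_min_ratio hint) ?_
    filter_upwards [eventually_gt_atTop 0] with k hk0
    have := hk k hk0
    rw [h1] at this
    have hk' : (0 : ℝ) < k := by exact_mod_cast hk0
    exact (div_le_div_iff_of_pos_right hk').1 (by linarith)
  have hsplit := measureReal_split (τ := τ)
  have n1 := measureReal_nonneg (μ := (τ : Measure ℝ≥0∞)) (s := {1})
  have n2 := measureReal_nonneg (μ := (τ : Measure ℝ≥0∞)) (s := Ioi 1)
  have z1 : (τ : Measure ℝ≥0∞) {1} = 0 := by
    rw [← measureReal_eq_zero_iff]; linarith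
  have z2 : (τ : Measure ℝ≥0∞) (Ioi 1) = 0 := by
    rw [← measureReal_eq_zero_iff]; linarith
  refine Or.inl ⟨ht, Measure.support_subset_of_isClosed isClosed_Icc ?_, ?_⟩
  · rw [mem_ae_iff]
    convert z2 using 2
    ext α; simp
  · rw [ratioIntegral_eq hint z1, integral_split hint, ratio_one, mul_zero, add_zero,
      setIntegral_measure_zero _ z2, add_zero]
    exact_mod_cast hI

end Positive

/-! ### Necessity for negative `t` -/

section Families

open Filter Topology

/-- The mixture of a uniform distribution on block `0` and, with weight `exp (-ε * L)`, a pair of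
blocks of which the second is smaller by `exp (-δ * L)`. -/
lemma isBlockWeight_nested {ε δ : ℝ} (hε : 0 < ε) (hδ : 0 < δ) :
    IsBlockWeight ![0, ε, ε + δ] Finset.univ 0 fun L =>
      ![1 - Real.exp (-ε * L), Real.exp (-ε * L) * (1 - Real.exp (-δ * L)),
        Real.exp (-ε * L) * Real.exp (-δ * L)] where
  sum_eq L := by simp [Fin.sum_univ_three]; ring
  eq_zero L j hj := absurd (Finset.mem_univ j) hj
  rate j _ := by
    fin_cases j
    · simpa using hasRate_one_sub_exp hε
    · simpa using (hasRate_exp (-ε)).mul (hasRate_one_sub_exp hδ)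
    · simpa [add_comm] using (hasRate_exp (-ε)).mul (hasRate_exp (-δ))
  mem := Finset.mem_univ _
  exponent_eq_zero := rfl
  tendsto j _ := by
    fin_cases j
    · simpa using (tendsto_exp_neg_mul hε).const_sub 1
    · simpa using (tendsto_exp_neg_mul hε).mul ((tendsto_exp_neg_mul hδ).const_sub 1)
    · simpa using (tendsto_exp_neg_mul hε).mul (tendsto_exp_neg_mul hδ)

/-- The even mixture of two pairs of blocks with the same main block. -/
lemma isBlockWeight_even {ε δ : ℝ} (hε : 0 < ε) (hδ : 0 < δ) :
    IsBlockWeight ![0, ε, δ] Finset.univ 0 fun L =>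
      ![2⁻¹ * (1 - Real.exp (-ε * L)) + 2⁻¹ * (1 - Real.exp (-δ * L)),
        2⁻¹ * Real.exp (-ε * L), 2⁻¹ * Real.exp (-δ * L)] where
  sum_eq L := by simp [Fin.sum_univ_three]; ring
  eq_zero L j hj := absurd (Finset.mem_univ j) hj
  rate j _ := by
    have h2 := hasRate_const (by norm_num : (0 : ℝ) < 2⁻¹)
    fin_cases j
    · simpa using (h2.mul (hasRate_one_sub_exp hε)).add (h2.mul (hasRate_one_sub_exp hδ))
    · simpa using h2.mul (hasRate_exp (-ε))
    · simpa using h2.mul (hasRate_exp (-δ))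
  mem := Finset.mem_univ _
  exponent_eq_zero := rfl
  tendsto j _ := by
    fin_cases j
    · have := (((tendsto_exp_neg_mul hε).const_sub 1).const_mul (2⁻¹ : ℝ)).add
        (((tendsto_exp_neg_mul hδ).const_sub 1).const_mul (2⁻¹ : ℝ))
      norm_num at this
      simpa using this
    · simpa using (tendsto_exp_neg_mul hε).const_mul (2⁻¹ : ℝ)
    · simpa using (tendsto_exp_neg_mul hδ).const_mul (2⁻¹ : ℝ)

end Families

section Negative

open Filter Topology

variable {t : ℝ} {τ : ProbabilityMeasure ℝ≥0∞}

/-- If `τ` charges `(1,∞]`, the quantities entering `I(τ)` are bounded at scale `ε`. The second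
distribution of the mixture has a larger block of size `exp ((1 + κ) L)`, which determines the
entropies of order less than `1`, and a small block of size `exp (b₂ L)`, which determines those of
order greater than `1`; here `b₂` balances the two terms of the mixture. -/
lemma mass_bound_of_neg (ht : t < 0) (hint : Integrable ratio (τ : Measure ℝ≥0∞))
    (h : (t, τ) ∈ Dbulk) {κ ε δ : ℝ} (hκ : 0 < κ) (hε : 0 < ε) (hδ : 0 < δ)
    (hT : 0 < (τ : Measure ℝ≥0∞).real (Ioi 1))
    (hsmall : ε / -t + κ ≤ (τ : Measure ℝ≥0∞).real (Ioi 1)) :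
    ε * (∫ α in Iio 1, min (ratio α) (κ / ε) ∂(τ : Measure ℝ≥0∞)) +
      κ * (τ : Measure ℝ≥0∞).real {1} ≤
      ε / t - (ε + δ) * ∫ α in Ioi 1, ratio α ∂(τ : Measure ℝ≥0∞) := by
  set A := (τ : Measure ℝ≥0∞).real (Iio 1) with hA
  set O := (τ : Measure ℝ≥0∞).real {1} with hO
  set T := (τ : Measure ℝ≥0∞).real (Ioi 1) with hT'
  have hsplit : A + O + T = 1 := measureReal_split
  have hA0 : 0 ≤ A := measureReal_nonneg
  have hO0 : 0 ≤ O := measureReal_nonneg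
  have hs : 0 < ε / -t := div_pos hε (neg_pos.2 ht)
  have hst : ε / -t = -(ε / t) := by rw [div_neg]
  set b₂ := (1 + ε / t - (1 + κ) * (A + O)) / T with hb₂
  have hbT : b₂ * T = 1 + ε / t - (1 + κ) * (A + O) := div_mul_cancel₀ _ hT.ne'
  have hb0 : 0 ≤ b₂ := by
    refine div_nonneg ?_ hT.le
    have : κ * (A + O) ≤ κ * 1 := mul_le_mul_of_nonneg_left (by linarith) hκ.le
    linarith
  have hb1 : b₂ ≤ 1 := by
    rw [hb₂, div_le_one hT]
    have : 0 ≤ κ * (A + O) := by positivity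
    linarith
  have hb : ∀ j, 0 ≤ (![1, 1 + κ, b₂] : Fin 3 → ℝ) j := by
    intro j
    fin_cases j
    · simp
    · simp; linarith
    · simpa using hb0
  have h₁ := isBlockWeight_single 0
  have h₂ := isBlockWeight_pair (i := 1) (j := 2) (by decide) hδ
  have hw := isBlockWeight_nested hε hδ
  have key := limit_le_max_of_mem_Dbulk ht h hb h₁ h₂ hw (hasRate_one_sub_exp hε)
    (c₂ := -ε) (by simpa using hasRate_exp (-ε)) (fun L j => by fin_cases j <;> simp)
  have e1 : ∀ α, limitEntropy ![1, 1 + κ, b₂] 0 {0} 0 h₁.nonempty α = 1 := fun α => by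
    simp [limitEntropy]
  have e2 := split_le_integral (c := 1 + κ) (g := fun _ => 1 + κ) (h := fun _ => b₂)
    (integrable_limitEntropy_and_tendsto h₂ hb τ).1 (integrable_const _) (integrable_const _)
    (fun α hα => le_trans (by simp) (le_limitEntropy_of_lt_one hα (j := 1) (by simp)))
    (by rw [limitEntropy_one]; simp)
    (fun α hα => le_limitEntropy_of_one_lt hα fun j hj => by
      have := ratio_le_neg_one hα
      fin_cases hj
      · simp; linarith
      · simp; nlinarith)
  have e3 := integral_le_split (c := 1) (g := fun α => 1 + κ - ε * min (ratio α) (κ / ε))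
    (h := fun α => b₂ - (ε + δ) * ratio α)
    (integrable_limitEntropy_and_tendsto hw hb τ).1
    ((integrable_const _).sub ((integrable_min_ratio hint _).const_mul _))
    ((integrable_const _).sub (hint.const_mul _))
    (fun α hα => limitEntropy_le_of_lt_one hα fun j hj => by
      have hr := ratio_nonneg hα
      have hm : ε * min (ratio α) (κ / ε) ≤ ε * ratio α :=
        mul_le_mul_of_nonneg_left (min_le_left _ _) hε.le
      have hm' : ε * min (ratio α) (κ / ε) ≤ ε * (κ / ε) :=
        mul_le_mul_of_nonneg_left (min_le_right _ _) hε.le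
      rw [mul_div_cancel₀ _ hε.ne'] at hm'
      fin_cases j
      · simp; linarith
      · simp; linarith
      · have : 0 ≤ ratio α * (ε + δ) := by positivity
        simp; linarith)
    (by rw [limitEntropy_one]; simp)
    (fun α hα => (limitEntropy_le_of_one_lt hα (j := 2) (by simp)).trans (by simp [mul_comm]))
  rw [integral_sub (integrable_const _) ((integrable_min_ratio hint _).const_mul _).integrableOn,
    integral_sub (integrable_const _) (hint.const_mul _).integrableOn,
    integral_const_mul, integral_const_mul] at e3
  simp only [e1, integral_const, measureReal_restrict_apply_univ, probReal_univ, smul_eq_mul,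
    mul_one, ← hA, ← hO, ← hT'] at key e2 e3
  -- Both terms of the maximum are at most `t`, by the choice of `b₂`.
  have h2 : 1 + ε / t ≤
      ∫ α, limitEntropy ![1, 1 + κ, b₂] (Pi.single 2 δ) {1, 2} 1 h₂.nonempty α
        ∂(τ : Measure ℝ≥0∞) := by linarith
  have h3 := mul_le_mul_of_nonpos_left h2 ht.le
  have h4 : t * (1 + ε / t) = t + ε := by
    rw [mul_add, mul_one, mul_div_cancel₀ _ ht.ne]
  have h5 := key.trans (max_le (by linarith : _ ≤ t) (by linarith))
  have h6 : 1 ≤ ∫ α, limitEntropy ![1, 1 + κ, b₂] ![0, ε, ε + δ] Finset.univ 0 hw.nonempty α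
      ∂(τ : Measure ℝ≥0∞) := by
    by_contra! hlt
    nlinarith
  linarith

/-- If `τ` charges `(1,∞]`, it does not charge `1` and its integral `I(τ)` is at most `1 / t`. -/
lemma integral_ratio_le_of_neg (ht : t < 0) (hint : Integrable ratio (τ : Measure ℝ≥0∞))
    (h : (t, τ) ∈ Dbulk) (hT : 0 < (τ : Measure ℝ≥0∞).real (Ioi 1)) :
    (τ : Measure ℝ≥0∞).real {1} = 0 ∧ ∫ α, ratio α ∂(τ : Measure ℝ≥0∞) ≤ 1 / t := by
  set T := (τ : Measure ℝ≥0∞).real (Ioi 1) with hT'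
  set O := (τ : Measure ℝ≥0∞).real {1} with hO
  set R := ∫ α in Ioi 1, ratio α ∂(τ : Measure ℝ≥0∞) with hR
  have hO0 : 0 ≤ O := measureReal_nonneg
  -- The bound for `κ = T / 2`, `ε = κ / k` and `δ = ε / k`, divided by `ε`.
  have key : ∀ᶠ k : ℕ in atTop,
      (∫ α in Iio 1, min (ratio α) k ∂(τ : Measure ℝ≥0∞)) + k * O ≤
        1 / t - R - R / k := by
    obtain ⟨N, hN⟩ := exists_nat_ge (1 / -t)
    filter_upwards [eventually_gt_atTop 0, eventually_ge_atTop N] with k hk0 hkN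
    have hk : (0 : ℝ) < k := by exact_mod_cast hk0
    have hε : 0 < T / 2 / k := by positivity
    have := mass_bound_of_neg (δ := T / 2 / k / k) ht hint h (half_pos hT) hε
      (by positivity) hT (by
        have h1 : 1 / -t ≤ k := hN.trans (by exact_mod_cast hkN)
        have h2 : T / 2 / k / -t = T / 2 / k * (1 / -t) := by ring
        have h3 := mul_le_mul_of_nonneg_left h1 hε.le
        rw [div_mul_cancel₀ _ hk.ne'] at h3
        rw [← hT', h2]
        linarith)
    have e : T / 2 / (T / 2 / k) = k := by field_simp
    rw [e, ← hO, ← hR] at this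
    refine le_of_mul_le_mul_left ?_ hε
    refine le_of_eq_of_le ?_ (this.trans_eq ?_)
    · field_simp
    · field_simp
      ring
  have hnn : ∀ k : ℕ, 0 ≤ ∫ α in Iio 1, min (ratio α) k ∂(τ : Measure ℝ≥0∞) := fun k =>
    setIntegral_min_ratio_nonneg k.cast_nonneg
  have hlim : Tendsto (fun k : ℕ => 1 / t - R - R / k) atTop (𝓝 (1 / t - R)) := by
    simpa using (tendsto_const_div_atTop_nhds_zero_nat R).const_sub (1 / t - R)
  have hO' : O = 0 := by
    refine le_antisymm ?_ hO0
    by_contra! hpos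
    have hdiv : Tendsto (fun k : ℕ => (k : ℝ) * O) atTop atTop :=
      tendsto_natCast_atTop_atTop.atTop_mul_const hpos
    refine not_tendsto_nhds_of_tendsto_atTop (tendsto_atTop_mono' _ ?_ hdiv) _ hlim
    filter_upwards [key] with k hk
    linarith [hnn k]
  refine ⟨hO', ?_⟩
  have := le_of_tendsto_of_tendsto (tendsto_setIntegral_min_ratio hint) hlim (by
    filter_upwards [key] with k hk
    rw [hO'] at hk
    linarith)
  rw [integral_split hint, ratio_one]
  linarith

/-- If `τ` charges `(1,∞]`, the function `min 1 (-ε * ratio α)` is almost everywhere constant there.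
It is the limit entropy of a test distribution, and its mean `c` is, up to a small `δ`, that of
another; the limit entropy of their mixture is the minimum of the two, whose integral is
smaller than that of `c` unless they agree. -/
lemma exists_ae_eq_const_of_neg (ht : t < 0) (hint : Integrable ratio (τ : Measure ℝ≥0∞))
    (h : (t, τ) ∈ Dbulk) (hT : 0 < (τ : Measure ℝ≥0∞).real (Ioi 1)) {ε : ℝ} (hε : 0 < ε) :
    ∃ c : ℝ, ∀ᵐ α ∂(τ : Measure ℝ≥0∞), α ∈ Ioi 1 → min 1 (-ε * ratio α) = c := by
  set T := (τ : Measure ℝ≥0∞).real (Ioi 1) with hT'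
  set f : ℝ≥0∞ → ℝ := fun α => min 1 (-ε * ratio α) with hf
  have hfi : Integrable f (τ : Measure ℝ≥0∞) := (integrable_const 1).inf (hint.const_mul (-ε))
  set c := (∫ α in Ioi 1, f α ∂(τ : Measure ℝ≥0∞)) / T with hc
  have hcT : c * T = ∫ α in Ioi 1, f α ∂(τ : Measure ℝ≥0∞) := div_mul_cancel₀ _ hT.ne'
  have hf0 : ∀ α ∈ Ioi (1 : ℝ≥0∞), 0 ≤ f α := fun α hα => by
    have := ratio_le_neg_one hα
    exact le_min zero_le_one (by nlinarith)
  have hc0 : 0 ≤ c := div_nonneg (setIntegral_nonneg measurableSet_Ioi hf0) hT.le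
  have hc1 : c ≤ 1 := by
    rw [hc, div_le_one hT]
    have := setIntegral_mono_on hfi.integrableOn (integrable_const (1 : ℝ)).integrableOn
      (s := Ioi 1) measurableSet_Ioi (fun α _ => min_le_left 1 (-ε * ratio α))
    rwa [setIntegral_const, smul_eq_mul, mul_one] at this
  have hb : ∀ j, 0 ≤ (![1, 0, c] : Fin 3 → ℝ) j := by
    intro j
    fin_cases j
    · simp
    · simp
    · simpa using hc0
  set g : ℝ≥0∞ → ℝ := fun α => min (f α) c with hg
  have hgi : Integrable g (τ : Measure ℝ≥0∞) := hfi.inf (integrable_const c)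
  have key : ∀ δ > 0, c * T ≤ (∫ α in Ioi 1, g α ∂(τ : Measure ℝ≥0∞)) -
      δ * ∫ α in Ioi 1, ratio α ∂(τ : Measure ℝ≥0∞) := by
    intro δ hδ
    have h₁ := isBlockWeight_pair (i := 0) (j := 1) (by decide) hε
    have h₂ := isBlockWeight_pair (i := 0) (j := 2) (by decide) hδ
    have hw := isBlockWeight_even hε hδ
    have h2 := hasRate_const (by norm_num : (0 : ℝ) < 2⁻¹)
    have half : (1 : ℝ) - 2⁻¹ = 2⁻¹ := by norm_num
    have key := limit_le_max_of_mem_Dbulk ht h hb h₁ h₂ hw h2 (c₂ := 0)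
      (by rwa [half]) (fun L j => by fin_cases j <;> simp [half])
    rw [zero_add, zero_add] at key
    have e1 := split_le_integral (c := 1) (g := fun _ => 1) (h := f)
      (integrable_limitEntropy_and_tendsto h₁ hb τ).1 (integrable_const _) hfi
      (fun α hα => le_trans (by simp) (le_limitEntropy_of_lt_one hα (j := 0) (by simp)))
      (by rw [limitEntropy_one]; simp)
      (fun α hα => le_limitEntropy_of_one_lt hα fun j hj => by
        fin_cases hj
        · simp [hf]
        · simp [hf, mul_comm])
    have e2 := split_le_integral (c := 1) (g := fun _ => 1) (h := fun _ => c)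
      (integrable_limitEntropy_and_tendsto h₂ hb τ).1 (integrable_const _) (integrable_const _)
      (fun α hα => le_trans (by simp) (le_limitEntropy_of_lt_one hα (j := 0) (by simp)))
      (by rw [limitEntropy_one]; simp)
      (fun α hα => le_limitEntropy_of_one_lt hα fun j hj => by
        have := ratio_le_neg_one hα
        fin_cases hj
        · simpa using hc1
        · simp; nlinarith)
    have e3 := integral_le_split (c := 1) (g := fun _ => 1) (h := fun α => g α - δ * ratio α)
      (integrable_limitEntropy_and_tendsto hw hb τ).1 (integrable_const _)
      (hgi.sub (hint.const_mul _))
      (fun α hα => limitEntropy_le_of_lt_one hα fun j hj => by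
        have hr := ratio_nonneg hα
        fin_cases j
        · simp
        · simp; nlinarith
        · simp; nlinarith)
      (by rw [limitEntropy_one]; simp)
      (fun α hα => by
        have hr := ratio_le_neg_one hα
        have l0 := limitEntropy_le_of_one_lt (b := ![1, 0, c]) (e := ![0, ε, δ]) (j₀ := 0)
          (hJ := hw.nonempty) hα (Finset.mem_univ 0)
        have l1 := limitEntropy_le_of_one_lt (b := ![1, 0, c]) (e := ![0, ε, δ]) (j₀ := 0)
          (hJ := hw.nonempty) hα (Finset.mem_univ 1)
        have l2 := limitEntropy_le_of_one_lt (b := ![1, 0, c]) (e := ![0, ε, δ]) (j₀ := 0)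
          (hJ := hw.nonempty) hα (Finset.mem_univ 2)
        simp at l0 l1 l2
        have hδr : δ * ratio α ≤ 0 := by nlinarith
        rw [le_sub_iff_add_le]
        refine le_min (le_min ?_ ?_) ?_ <;> linarith)
    rw [integral_sub hgi.integrableOn (hint.const_mul _).integrableOn, integral_const_mul] at e3
    simp only [integral_const, measureReal_restrict_apply_univ, smul_eq_mul,
      mul_one, ← hT'] at e1 e2 e3
    rw [← hcT] at e1
    rcases le_max_iff.1 key with hk | hk
    · have := (mul_le_mul_left_of_neg ht).1 hk
      linarith
    · have := (mul_le_mul_left_of_neg ht).1 hk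
      linarith
  have hle : c * T ≤ ∫ α in Ioi 1, g α ∂(τ : Measure ℝ≥0∞) := by
    have hlim : Tendsto (fun δ : ℝ => (∫ α in Ioi 1, g α ∂(τ : Measure ℝ≥0∞)) -
        δ * ∫ α in Ioi 1, ratio α ∂(τ : Measure ℝ≥0∞)) (𝓝[>] 0)
        (𝓝 ((∫ α in Ioi 1, g α ∂(τ : Measure ℝ≥0∞)) -
          0 * ∫ α in Ioi 1, ratio α ∂(τ : Measure ℝ≥0∞))) := by
      refine Tendsto.mono_left (Continuous.tendsto ?_ _) nhdsWithin_le_nhds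
      fun_prop
    rw [zero_mul, sub_zero] at hlim
    exact ge_of_tendsto hlim (eventually_mem_nhdsWithin.mono key)
  -- As `g ≤ f` and `g ≤ c`, and all three have the same integral, they agree almost everywhere.
  have hgf : (fun α => f α - g α) =ᵐ[(τ : Measure ℝ≥0∞).restrict (Ioi 1)] 0 := by
    refine (integral_eq_zero_iff_of_nonneg (fun α => sub_nonneg.2 (min_le_left _ _))
      (hfi.sub hgi).integrableOn).1 (le_antisymm ?_
        (integral_nonneg fun α => sub_nonneg.2 (min_le_left _ _)))
    rw [integral_sub hfi.integrableOn hgi.integrableOn]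
    linarith
  have hgc : (fun α => c - g α) =ᵐ[(τ : Measure ℝ≥0∞).restrict (Ioi 1)] 0 := by
    refine (integral_eq_zero_iff_of_nonneg (fun α => sub_nonneg.2 (min_le_right _ _))
      ((integrable_const c).sub hgi).integrableOn).1 (le_antisymm ?_
        (integral_nonneg fun α => sub_nonneg.2 (min_le_right _ _)))
    rw [integral_sub (integrable_const c) hgi.integrableOn]
    simp only [integral_const, measureReal_restrict_apply_univ, smul_eq_mul, ← hT']
    linarith
  refine ⟨c, (ae_restrict_iff' measurableSet_Ioi).1 ?_⟩
  filter_upwards [hgf, hgc] with α h1 h2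
  have h1' : f α - g α = 0 := h1
  have h2' : c - g α = 0 := h2
  change f α = c
  linarith

lemma ratio_lt_ratio {α β : ℝ≥0∞} (hα : 1 < α) (hαβ : α < β) : ratio α < ratio β := by
  have hα' := one_lt_toReal hα hαβ.ne_top
  have h1 : 0 < α.toReal - 1 := by linarith
  have e : ∀ x : ℝ, 1 < x → x / (1 - x) = -1 - 1 / (x - 1) := fun x hx => by
    have : x - 1 ≠ 0 := by linarith
    have : 1 - x ≠ 0 := by linarith
    field_simp
    ring
  rw [ratio_eq hαβ.ne_top, e _ hα']
  by_cases ht : β = ⊤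
  · rw [ht, ratio_top]
    have := one_div_pos.2 h1
    linarith
  · have hlt := (ENNReal.toReal_lt_toReal hαβ.ne_top ht).2 hαβ
    rw [ratio_eq ht, e _ (hα'.trans hlt)]
    have := one_div_lt_one_div_of_lt h1 (by linarith : α.toReal - 1 < β.toReal - 1)
    linarith

/-- At most one point of the support lies in `(1,∞]`. -/
lemma not_two_mem_support_of_neg (ht : t < 0) (hint : Integrable ratio (τ : Measure ℝ≥0∞))
    (h : (t, τ) ∈ Dbulk) {a b : ℝ≥0∞} (ha1 : 1 < a) (hab : a < b)
    (ha : a ∈ (τ : Measure ℝ≥0∞).support) (hb : b ∈ (τ : Measure ℝ≥0∞).support) : False := by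
  obtain ⟨a', ha'1, ha'a⟩ := exists_between ha1
  obtain ⟨d, had, hdb⟩ := exists_between hab
  rw [Measure.mem_support_iff_forall] at ha hb
  have hU := ha (Ioo a' d) (Ioo_mem_nhds ha'a had)
  have hV := hb (Ioi d) (Ioi_mem_nhds hdb)
  have hT : 0 < (τ : Measure ℝ≥0∞).real (Ioi 1) :=
    ENNReal.toReal_pos (ha (Ioi 1) (Ioi_mem_nhds ha1)).ne' (measure_ne_top _ _)
  have hra' := ratio_le_neg_one ha'1
  -- With this `ε` the truncation at `1` is inactive beyond `a'`.
  obtain ⟨c, hc⟩ := exists_ae_eq_const_of_neg (ε := 1 / -ratio a') ht hint h hT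
    (one_div_pos.2 (by linarith))
  have hex : ∀ s : Set ℝ≥0∞, 0 < (τ : Measure ℝ≥0∞) s → ∃ α ∈ s,
      (α ∈ Ioi 1 → min 1 (-(1 / -ratio a') * ratio α) = c) := fun s hs => by
    by_contra! hcon
    refine hs.ne' (measure_mono_null (fun α hα => ?_) hc)
    intro hP
    exact (hcon α hα).2 (hP (hcon α hα).1)
  obtain ⟨α, ⟨hα1, hα2⟩, hα⟩ := hex _ hU
  obtain ⟨β, hβ1, hβ⟩ := hex _ hV
  have hβ1 : d < β := hβ1
  have h1α : 1 < α := ha'1.trans hα1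
  have e : ∀ γ : ℝ≥0∞, a' < γ → min 1 (-(1 / -ratio a') * ratio γ) = ratio γ / ratio a' :=
    fun γ hγ => by
    have := ratio_lt_ratio ha'1 hγ
    have e : -(1 / -ratio a') * ratio γ = ratio γ / ratio a' := by
      rw [one_div_neg_eq_neg_one_div]; ring
    rw [e, min_eq_right]
    rw [div_le_one_of_neg (by linarith)]
    exact this.le
  have hαβ := hα2.trans hβ1
  have h1 := hα h1α
  have h2 := hβ (h1α.trans hαβ)
  rw [e α hα1] at h1
  rw [e β (hα1.trans hαβ)] at h2
  have hne : ratio a' ≠ 0 := by linarith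
  have := (div_left_inj' hne).1 (h1.trans h2.symm)
  exact (ratio_lt_ratio h1α hαβ).ne this

lemma mem_DbulkTilde_of_neg (ht : t < 0) (hint : Integrable ratio (τ : Measure ℝ≥0∞))
    (h : (t, τ) ∈ Dbulk) : (t, τ) ∈ DbulkTilde := by
  by_cases hs : (τ : Measure ℝ≥0∞).support ⊆ Icc 0 1
  · exact Or.inr ⟨ht, Or.inl hs⟩
  obtain ⟨a, ha, ha1⟩ := not_subset.1 hs
  have ha1 : 1 < a := by simpa using ha1
  have hT : 0 < (τ : Measure ℝ≥0∞).real (Ioi 1) := by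
    rw [Measure.mem_support_iff_forall] at ha
    exact ENNReal.toReal_pos (ha (Ioi 1) (Ioi_mem_nhds ha1)).ne' (measure_ne_top _ _)
  obtain ⟨hO, hI⟩ := integral_ratio_le_of_neg ht hint h hT
  refine Or.inr ⟨ht, Or.inr ⟨a, ha1, fun b hb => ?_, ?_⟩⟩
  · rcases le_or_gt b 1 with hb1 | hb1
    · exact Or.inl ⟨zero_le, hb1⟩
    · rcases lt_trichotomy a b with hlt | heq | hlt
      · exact (not_two_mem_support_of_neg ht hint h ha1 hlt ha hb).elim
      · exact Or.inr heq.symm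
      · exact (not_two_mem_support_of_neg ht hint h hb1 hlt hb ha).elim
  · rw [ratioIntegral_eq hint (by rwa [← measureReal_eq_zero_iff])]
    exact_mod_cast hI

end Negative

end CondEntropy

theorem mainTheorem4 :
    CondEntropy.DbulkTilde ⊆ CondEntropy.Dbulk ∧
    CondEntropy.DnegInftyTilde ⊆ CondEntropy.DnegInfty ∧
    (∀ (t : ℝ) (τ : ProbabilityMeasure ℝ≥0∞), CondEntropy.FiniteRatioIntegrals τ →
      ((t, τ) ∈ CondEntropy.Dbulk ↔ (t, τ) ∈ CondEntropy.DbulkTilde)) ∧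
    (∀ τ : ProbabilityMeasure ℝ≥0∞, (τ : Measure ℝ≥0∞).support.Finite →
      CondEntropy.FiniteRatioIntegrals τ) := by
  refine ⟨CondEntropy.DbulkTilde_subset, CondEntropy.DnegInftyTilde_subset, fun t τ hτ =>
    ⟨fun h => ?_, fun h => CondEntropy.DbulkTilde_subset h⟩,
    fun τ hτ => CondEntropy.finiteRatioIntegrals_of_finite_support hτ⟩
  rcases lt_or_gt_of_ne h.1 with ht | ht
  · exact CondEntropy.mem_DbulkTilde_of_neg ht hτ.integrable h
  · exact CondEntropy.mem_DbulkTilde_of_pos ht hτ.integrable h
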